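/- **Conventions.** Spacetime is $\mathbb R^4$, $\eta=\operatorname{diag}(1,-1,-1,-1)$, repeated indices are summed, $\kappa\ne 0$ and $\epsilon$ are real. A perturbation $h_{\mu\nu}=h_{\nu\mu}$ has real Schwartz components; $g_{\mu\nu}=\eta_{\mu\nu}+\kappa h_{\mu\nu}$, $g^{\mu\nu}$ is the inverse matrix, $\Gamma^\alpha_{\mu\nu}=\tfrac12 g^{\alpha\beta}(\partial_\mu g_{\nu\beta}+\partial_\nu g_{\mu\beta}-\partial_\beta g_{\mu\nu})$, $R_{\mu\nu}{}^\alpha{}_\beta=\partial_\mu\Gamma^\alpha_{\nu\beta}-\partial_\nu\Gamma^\alpha_{\mu\beta}+\Gamma^\alpha_{\mu\sigma}\Gamma^\sigma_{\nu\beta}-\Gamma^\alpha_{\nu\sigma}\Gamma^\sigma_{\mu\beta}$, $R_{\mu\nu}=R_{\rho\mu}{}^\rho{}_\nu$, $R=g^{\mu\nu}R_{\mu\nu}$, and $\mathcal G^\mu=g^{\alpha\beta}\Gamma^\mu_{\alpha\beta}$. Put $$\mathcal A[h]=\int d^4x\,\sqrt{-g}\,\Big[-\frac{2}{\kappa^2}R+\frac{\epsilon}{2\kappa^2}\,g_{\mu\nu}\mathcal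 G^\mu\mathcal G^\nu\Big].$$ Fourier transforms are $h_{\mu\nu}(p)=\int d^4x\,e^{ip_\lambda x^\lambda}h_{\mu\nu}(x)$. For a function $X$ of the metric components, $(X)^{\rho_1\sigma_1\cdots\rho_n\sigma_n}$ denotes its $n$-th Taylor coefficient at $\eta$ (with the factor $1/n!$), symmetric in the pairs $\rho_i\sigma_i$ and within each pair, so that $X=\sum_n\kappa^n(X)^{\rho_1\sigma_1\cdots\rho_n\sigma_n}h_{\rho_1\sigma_1}\cdots h_{\rho_n\sigma_n}$. Finally $$(\Gamma_{\mu\alpha\beta})^{\lambda\rho\sigma}=\tfrac12\big[\delta^\lambda_\alpha I_{\beta\mu}{}^{\rho\sigma}+\delta^\lambda_\beta I_{\alpha\mu}{}^{\rho\sigma}-\delta^\lambda_\mu I_{\alpha\beta}{}^{\rho\sigma}\big],\qquad I_{\mu\nu}{}^{\rho\sigma}=\tfrac12(\delta^\rho_\mu\delta^\sigma_\nu+\delta^\sigma_\mu\delta^\rho_\nu),$$ and for $n\ge0$ $$\begin{aligned}K_n&=2\kappa^n\,\big(\sqrt{-g}\,g^{\mu\nu}g^{\alpha\beta}g^{\r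ho\sigma}\big)^{\rho_1\sigma_1\cdots\rho_n\sigma_n}(p_1)_{\lambda_1}(p_2)_{\lambda_2}\Big[(\Gamma_{\alpha\mu\rho})^{\lambda_1\mu_1\nu_1}(\Gamma_{\sigma\nu\beta})^{\lambda_2\mu_2\nu_2}\\&\qquad-(\Gamma_{\alpha\mu\nu})^{\lambda_1\mu_1\nu_1}(\Gamma_{\rho\beta\sigma})^{\lambda_2\mu_2\nu_2}-\tfrac{\epsilon}{4}(\Gamma_{\mu\alpha\beta})^{\lambda_1\mu_1\nu_1}(\Gamma_{\nu\rho\sigma})^{\lambda_2\mu_2\nu_2}\Big].\end{aligned}$$ **Theorem.** (1) Let $h$ be small in the sense that for every $x$ all complex eigenvalues of the matrix $\kappa h^\mu{}_\nu(x)=\kappa\eta^{\mu\sigma}h_{\sigma\nu}(x)$ have modulus less than $1$. Then the action integral converges absolutely and $$\mathcal A[h]=\sum_{n=0}^\infty\int\frac{d^4p_1}{(2\pi)^4}\frac{d^4p_2}{(2\pi)^4}\prod_{i=1}^n\frac{d^4k_i}{(2\pi)^4}\,(2\pi)^4\delta\Big(p_1+p_2+\sum_i k_i\Big)\,K_n\,h_{\mu_1\nu_1}(p_1)h_{\mu_2\nu_2}(p_2)\prod_{i=1}^n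 h_{\rho_i\sigma_i}(k_i),$$ where every momentum integral and the series converge absolutely. (2) For $N=n+2\ge2$ the $N$-graviton vertex is $$V_N^{\mu_1\nu_1\cdots\mu_N\nu_N}(p_1,\dots,p_N)=i\sum_{\text{permutations of }\{\mu_i\nu_i\,p_i\}}K_{N-2}\,,$$ where in $K_{N-2}$ the legs $3,\dots,N$ play the role of $(\rho_i\sigma_i,k_i)$; that is, for all symmetric Schwartz perturbations $\varphi^1,\dots,\varphi^N$ the function $(t_1,\dots,t_N)\mapsto\mathcal A[\sum_i t_i\varphi^i]$ is analytic at $0$ and $$i\,\frac{\partial^N}{\partial t_1\cdots\partial t_N}\mathcal A\Big[\sum_i t_i\varphi^i\Big]\Big|_{t=0}=\int\prod_{i=1}^N\frac{d^4p_i}{(2\pi)^4}\,(2\pi)^4\delta\Big(\sum_i p_i\Big)\,V_N^{\mu_1\nu_1\cdots\mu_N\nu_N}(p_1,\dots,p_N)\,\prod_{i=1}^N\varphi^i_{\mu_i\nu_i}(p_i),$$ the integral converging absolutely. -/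

import Mathlib

open scoped SchwartzMap

noncomputable section

namespace PerturbativeGravity

/-- Four-dimensional spacetime with coordinates `x 0, x 1, x 2, x 3`. Momenta, given by their
covariant components `p 0, p 1, p 2, p 3`, live in the same coordinate space. -/
abbrev Spacetime : Type := EuclideanSpace ℝ (Fin 4)

/-- The Minkowski metric `diag(+,-,-,-)`. -/
def eta : Matrix (Fin 4) (Fin 4) ℝ := Matrix.diagonal ![1, -1, -1, -1]

/-- A metric perturbation `h_{μν}`, given by its components, which are real Schwartz functions. -/
abbrev Perturbation : Type := Fin 4 → Fin 4 → 𝓢(Spacetime, ℝ)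

/-- Symmetry of the tensor field `h_{μν}`. -/
def Perturbation.IsSymm (h : Perturbation) : Prop := ∀ μ ν, h μ ν = h ν μ

/-- The matrix `(h_{μν}(x))`. -/
def Perturbation.matrixAt (h : Perturbation) (x : Spacetime) : Matrix (Fin 4) (Fin 4) ℝ :=
  Matrix.of fun μ ν => h μ ν x

/-- The perturbed metric `g_{μν}(x) = η_{μν} + κ h_{μν}(x)`. -/
def metric (κ : ℝ) (h : Perturbation) (x : Spacetime) : Matrix (Fin 4) (Fin 4) ℝ :=
  eta + κ • h.matrixAt x

section Geometry

/-- The partial derivative `∂_μ f` at `x`. -/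
def pd (μ : Fin 4) (f : Spacetime → ℝ) (x : Spacetime) : ℝ :=
  fderiv ℝ f x (EuclideanSpace.single μ 1)

/-- The Christoffel symbols `Γ^a_{μν}` of a metric `g`. -/
def christoffel (g : Spacetime → Matrix (Fin 4) (Fin 4) ℝ) (a μ ν : Fin 4) (x : Spacetime) : ℝ :=
  (1 / 2) * ∑ β, (g x)⁻¹ a β *
    (pd μ (fun y => g y ν β) x + pd ν (fun y => g y μ β) x - pd β (fun y => g y μ ν) x)

/-- The Riemann tensor `R_{μν}{}^a{}_β`. -/
def riemann (g : Spacetime → Matrix (Fin 4) (Fin 4) ℝ) (μ ν a β : Fin 4) (x : Spacetime) : ℝ :=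
  pd μ (christoffel g a ν β) x - pd ν (christoffel g a μ β) x
    + ∑ σ, (christoffel g a μ σ x * christoffel g σ ν β x
      - christoffel g a ν σ x * christoffel g σ μ β x)

/-- The Ricci tensor `R_{μν} = R_{ρμ}{}^ρ{}_ν`. -/
def ricci (g : Spacetime → Matrix (Fin 4) (Fin 4) ℝ) (μ ν : Fin 4) (x : Spacetime) : ℝ :=
  ∑ ρ, riemann g ρ μ ρ ν x

/-- The scalar curvature `R = g^{μν} R_{μν}`. -/
def scalarCurvature (g : Spacetime → Matrix (Fin 4) (Fin 4) ℝ) (x : Spacetime) : ℝ :=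
  ∑ μ, ∑ ν, (g x)⁻¹ μ ν * ricci g μ ν x

/-- The volume factor `√(-det g)`. -/
def volumeFactor (M : Matrix (Fin 4) (Fin 4) ℝ) : ℝ := Real.sqrt (-M.det)

/-- The gauge fixing vector `𝒢^μ = g^{αβ} Γ^μ_{αβ}`. -/
def gaugeVector (g : Spacetime → Matrix (Fin 4) (Fin 4) ℝ) (μ : Fin 4) (x : Spacetime) : ℝ :=
  ∑ α, ∑ β, (g x)⁻¹ α β * christoffel g μ α β x

end Geometry

/-- The integrand `√(-g) [ -(2/κ²) R + (ε/(2κ²)) g_{μν} 𝒢^μ 𝒢^ν ]`. -/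
def lagrangian (κ ε : ℝ) (h : Perturbation) (x : Spacetime) : ℝ :=
  volumeFactor (metric κ h x) *
    (-(2 / κ ^ 2) * scalarCurvature (metric κ h) x
      + ε / (2 * κ ^ 2) * ∑ μ, ∑ ν, metric κ h x μ ν *
          gaugeVector (metric κ h) μ x * gaugeVector (metric κ h) ν x)

/-- The Einstein-Hilbert action with the gauge fixing term. -/
def action (κ ε : ℝ) (h : Perturbation) : ℝ := ∫ x, lagrangian κ ε h x

/-- An index pair `ρσ`. -/
abbrev IndexPair : Type := Fin 4 × Fin 4

/-- The symmetric matrix unit `(E_{ρσ} + E_{σρ}) / 2`; differentiating along it is the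
derivative `∂ / ∂h_{ρσ}` with respect to a symmetric tensor `h`. -/
def symUnit (a : IndexPair) : Fin 4 → Fin 4 → ℝ := fun μ ν =>
  ((if μ = a.1 ∧ ν = a.2 then 1 else 0) + (if μ = a.2 ∧ ν = a.1 then 1 else 0)) / 2

/-- The tensor `(X)^{ρ₁σ₁⋯ρₙσₙ}`: the `n`-th Taylor coefficient at `0`, symmetric in the index
pairs and within each of them, of a function `X` of the components of `H = κ h`, so that
`X = ∑ₙ κⁿ (X)^{ρ₁σ₁⋯ρₙσₙ} h_{ρ₁σ₁} ⋯ h_{ρₙσₙ}`. -/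
def expansionCoeff (X : (Fin 4 → Fin 4 → ℝ) → ℝ) (n : ℕ) (a : Fin n → IndexPair) : ℝ :=
  (n.factorial : ℝ)⁻¹ * iteratedFDeriv ℝ n X 0 (fun i => symUnit (a i))

/-- `√(-g) g^{μν} g^{αβ} g^{ρσ}` as a function of `H`, where `g = η + H`. -/
def volumeInvInvInv (μ ν α β ρ σ : Fin 4) (H : Fin 4 → Fin 4 → ℝ) : ℝ :=
  volumeFactor (eta + Matrix.of H) * (eta + Matrix.of H)⁻¹ μ ν *
    (eta + Matrix.of H)⁻¹ α β * (eta + Matrix.of H)⁻¹ ρ σ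

/-- The Kronecker symbol. -/
def kron (μ ν : Fin 4) : ℝ := if μ = ν then 1 else 0

/-- `I_{μν}{}^{ρσ} = (δ_μ^ρ δ_ν^σ + δ_μ^σ δ_ν^ρ) / 2`. -/
def symIdentity (μ ν : Fin 4) (a : IndexPair) : ℝ :=
  (kron μ a.1 * kron ν a.2 + kron μ a.2 * kron ν a.1) / 2

/-- The Christoffel tensor
`(Γ_{μαβ})^{λρσ} = (δ^λ_α I_{βμ}{}^{ρσ} + δ^λ_β I_{αμ}{}^{ρσ} - δ^λ_μ I_{αβ}{}^{ρσ}) / 2`. -/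
def christoffelTensor (μ α β l : Fin 4) (a : IndexPair) : ℝ :=
  (1 / 2) * (kron l α * symIdentity β μ a + kron l β * symIdentity α μ a
    - kron l μ * symIdentity α β a)

/-- The bilinear combination of Christoffel tensors, with `a₁ = μ₁ν₁` and `a₂ = μ₂ν₂`:
`(Γ_{αμρ})^{λ₁μ₁ν₁} (Γ_{σνβ})^{λ₂μ₂ν₂} - (Γ_{αμν})^{λ₁μ₁ν₁} (Γ_{ρβσ})^{λ₂μ₂ν₂}
  - (ε/4) (Γ_{μαβ})^{λ₁μ₁ν₁} (Γ_{νρσ})^{λ₂μ₂ν₂}`. -/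
def christoffelBilinear (ε : ℝ) (μ ν α β ρ σ l₁ l₂ : Fin 4) (a₁ a₂ : IndexPair) : ℝ :=
  christoffelTensor α μ ρ l₁ a₁ * christoffelTensor σ ν β l₂ a₂
    - christoffelTensor α μ ν l₁ a₁ * christoffelTensor ρ β σ l₂ a₂
    - ε / 4 * (christoffelTensor μ α β l₁ a₁ * christoffelTensor ν ρ σ l₂ a₂)

/-- The momentum kernel of the `n`-th term of the series. It has `n + 2` legs: legs `0` and `1`
carry the momenta `p₁`, `p₂`, and leg `i + 2` carries the momentum `kᵢ`. -/
def kernel (κ ε : ℝ) (n : ℕ) (p : Fin (n + 2) → Spacetime) (a : Fin (n + 2) → IndexPair) : ℝ :=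
  2 * κ ^ n * ∑ μ, ∑ ν, ∑ α, ∑ β, ∑ ρ, ∑ σ,
    expansionCoeff (volumeInvInvInv μ ν α β ρ σ) n (fun i => a i.succ.succ) *
      ∑ l₁, ∑ l₂, p 0 l₁ * p 1 l₂ * christoffelBilinear ε μ ν α β ρ σ l₁ l₂ (a 0) (a 1)

/-- The Fourier transform `f(p) = ∫ d⁴x e^{i p·x} f(x)`, so that
`f(x) = ∫ d⁴p/(2π)⁴ e^{-i p·x} f(p)` and `∂_μ` becomes `-i p_μ`; here `p·x = p_μ x^μ`. -/
def fourier (f : 𝓢(Spacetime, ℝ)) (p : Spacetime) : ℂ :=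
  ∫ x : Spacetime, Complex.exp (Complex.I * ((∑ μ, p μ * x μ : ℝ) : ℂ)) * (f x : ℂ)

/-- The point of momentum space with `p₀ + ⋯ + p_m = 0` and with prescribed `p₁, …, p_m`. -/
def conserved {m : ℕ} (q : Fin m → Spacetime) : Fin (m + 1) → Spacetime :=
  Fin.cons (-∑ i, q i) q

/-- `∫ ∏_{i=0}^{m} d⁴pᵢ/(2π)⁴ (2π)⁴ δ(p₀ + ⋯ + p_m) F(p)`, the delta function being used to carry
out the integral over `p₀`. -/
def deltaIntegral (m : ℕ) (F : (Fin (m + 1) → Spacetime) → ℂ) : ℂ :=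
  (((2 * Real.pi) ^ (4 * m) : ℝ) : ℂ)⁻¹ * ∫ q : Fin m → Spacetime, F (conserved q)

/-- `∑ K^{a₀⋯a_m}(p) φ⁰_{a₀}(p₀) ⋯ φᵐ_{a_m}(p_m)`, summed over the index pairs: a kernel contracted
with the Fourier transforms of the fields attached to its legs. -/
def contract {m : ℕ} (K : (Fin m → Spacetime) → (Fin m → IndexPair) → ℂ)
    (φ : Fin m → Perturbation) (p : Fin m → Spacetime) : ℂ :=
  ∑ a : Fin m → IndexPair, K p a * ∏ i, fourier (φ i (a i).1 (a i).2) (p i)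

/-- The vertex with `n + 2` gravitons: `i` times the kernel, summed over all permutations of the
graviton parameters. -/
def vertex (κ ε : ℝ) (n : ℕ) (p : Fin (n + 2) → Spacetime) (a : Fin (n + 2) → IndexPair) : ℂ :=
  Complex.I * ∑ π : Equiv.Perm (Fin (n + 2)), (kernel κ ε n (p ∘ π) (a ∘ π) : ℂ)

/-- Smallness of the perturbation: at every point all (complex) eigenvalues of the matrix
`κ h^μ{}_ν = κ η^{μσ} h_{σν}` have modulus less than one. -/
def IsSmall (κ : ℝ) (h : Perturbation) : Prop :=
  ∀ x, ∀ z ∈ spectrum ℂ ((κ • (eta * h.matrixAt x)).map (algebraMap ℝ ℂ)), ‖z‖ < 1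

end PerturbativeGravity

end

/-! The second derivatives in `√(-g) R` form a divergence. Metric compatibility turns `√(-g) R` into
a quadratic form in the Christoffel symbols plus `∂_μ` of `boundaryVector`
(`curvature_tensor_identity`, `lagrangian_decomposition`). For Schwartz perturbations this vector
and its divergence are integrable, so the divergence integrates to zero (`integral_lagrangian`).
With lowered indices each Christoffel symbol is `κ` times an expression linear in `∂h`, so the
factor `κ²` cancels the `1/κ²` in front. What remains is `-2 ∫ √(-g) g⁻¹ g⁻¹ g⁻¹ (∂h)(∂h)`, where
only the undifferentiated factor `volumeInvInvInv` is nonpolynomial in `h`.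

That factor is expanded in `H = κ h(x)`. The eigenvalue condition says exactly what is needed for
`det (η + z H) ≠ 0` on the closed unit disc. The values of `κ h`, together with their limit `0` at
infinity, form a compact set, so the same holds on a disc of one radius `R > 1` for all `x`. There
`z ↦ √(-det) g⁻¹ g⁻¹ g⁻¹` is holomorphic, and Cauchy's estimates bound the `n`-th Taylor term by `M
s⁻ⁿ` with `s > 1`, uniformly in `x` (`exists_taylorTerm_bound`). Sum and integral may then be
interchanged (`hasSum_integral_positionIntegrand`).

Each order is an integral of a product of Schwartz functions, which Fubini and Fourier inversion
turn into the momentum integral with the delta function (`deltaIntegral_prod_fourier`). The two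
derivatives give `p₁ p₂` and a sign `i² = -1`, which changes the prefactor `-2` into the `2` of the
kernel.

For the vertices, the series is applied to `∑ tᵢ φᵢ` and expanded multilinearly. Geometric bounds on
all coefficients make it a convergent power series in `t` (`exists_hasFPowerSeriesOnBall_action`),
and its mixed derivative at `0` is the sum of the coefficients over all permutations of the legs
(`iteratedFDeriv_action`). -/

open scoped SchwartzMap FourierTransform LineDeriv
open MeasureTheory

namespace PerturbativeGravity

/-! ### Fourier transforms of Schwartz functions and momentum-conserving integrals. -/

section FourierAnalysis

/-- A real Schwartz function regarded as a complex one. -/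
noncomputable def complexify (f : 𝓢(Spacetime, ℝ)) : 𝓢(Spacetime, ℂ) :=
  f.postcompCLM Complex.ofRealCLM

@[simp]
theorem complexify_apply (f : 𝓢(Spacetime, ℝ)) (x : Spacetime) : complexify f x = (f x : ℂ) := rfl

theorem sum_mul_eq_inner (p x : Spacetime) : ∑ μ, p μ * x μ = inner ℝ x p := by
  simp [PiLp.inner_apply]

/-- `𝓕` has the phase `e^{-2πi⟨x,ξ⟩}`, so the convention `e^{ip·x}` corresponds to `ξ = -p/(2π)`. -/
theorem fourier_eq_fourierTransform (f : 𝓢(Spacetime, ℝ)) (p : Spacetime) :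
    fourier f p = 𝓕 (complexify f) ((-(2 * Real.pi)⁻¹) • p) := by
  rw [SchwartzMap.fourier_coe, Real.fourier_eq']
  unfold fourier
  congr 1
  ext x
  rw [sum_mul_eq_inner, inner_smul_right, complexify_apply, smul_eq_mul]
  congr 2
  have : (Real.pi : ℂ) ≠ 0 := by exact_mod_cast Real.pi_ne_zero
  push_cast
  field_simp

theorem continuous_fourier (f : 𝓢(Spacetime, ℝ)) : Continuous (fourier f) := by
  have : fourier f = fun p => 𝓕 (complexify f) ((-(2 * Real.pi)⁻¹) • p) :=
    funext fun p => fourier_eq_fourierTransform f p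
  rw [this]
  exact (𝓕 (complexify f)).continuous.comp (continuous_const_smul _)

theorem integrable_fourier (f : 𝓢(Spacetime, ℝ)) : Integrable (fourier f) := by
  have : fourier f = fun p => 𝓕 (complexify f) ((-(2 * Real.pi)⁻¹) • p) :=
    funext fun p => fourier_eq_fourierTransform f p
  rw [this]
  exact (𝓕 (complexify f)).integrable.comp_smul (by simp [Real.pi_ne_zero])

theorem norm_fourier_le (f : 𝓢(Spacetime, ℝ)) : ∃ C, ∀ p, ‖fourier f p‖ ≤ C := by
  refine ⟨∫ x, ‖f x‖, fun p => (norm_integral_le_integral_norm _).trans_eq ?_⟩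
  congr 1
  ext x
  rw [norm_mul, mul_comm Complex.I, Complex.norm_exp_ofReal_mul_I, one_mul, Complex.norm_real]

/-- The plane wave `e^{-i p·x}`. -/
noncomputable def phase (p x : Spacetime) : ℂ :=
  Complex.exp (-(Complex.I * ((∑ μ, p μ * x μ : ℝ) : ℂ)))

theorem fourier_inversion (f : 𝓢(Spacetime, ℝ)) (x : Spacetime) :
    (f x : ℂ) = (((2 * Real.pi) ^ 4 : ℝ) : ℂ)⁻¹ *
      ∫ p : Spacetime, phase p x * fourier f p := by
  have h1 : (f x : ℂ) = 𝓕⁻ (𝓕 (complexify f)) x := by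
    rw [FourierTransform.fourierInv_fourier_eq]; rfl
  rw [h1, SchwartzMap.fourierInv_coe, Real.fourierInv_eq']
  have h2 := Measure.integral_comp_smul (volume : Measure Spacetime)
    (fun v : Spacetime => Complex.exp (↑(2 * Real.pi * inner ℝ v x) * Complex.I) •
      𝓕 (complexify f) v) (-(2 * Real.pi)⁻¹)
  -- The Jacobian of `ξ = -p/(2π)` in four dimensions; it is the source of the measure `d⁴p/(2π)⁴`.
  have h3 : |((-(2 * Real.pi)⁻¹) ^ Module.finrank ℝ Spacetime)⁻¹| = (2 * Real.pi) ^ 4 := by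
    rw [finrank_euclideanSpace_fin]
    simp only [Even.neg_pow (by decide : Even 4), inv_pow, inv_inv]
    exact abs_of_nonneg (by positivity)
  rw [h3] at h2
  have h4 : (fun p : Spacetime => phase p x * fourier f p) = fun p : Spacetime =>
      Complex.exp (↑(2 * Real.pi * inner ℝ ((-(2 * Real.pi)⁻¹) • p) x) * Complex.I) •
      𝓕 (complexify f) ((-(2 * Real.pi)⁻¹) • p) := by
    ext p
    rw [phase, fourier_eq_fourierTransform, smul_eq_mul, sum_mul_eq_inner, inner_smul_left,
      real_inner_comm x p]
    congr 2
    have : (Real.pi : ℂ) ≠ 0 := by exact_mod_cast Real.pi_ne_zero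
    simp
    field_simp
  rw [h4, h2, Complex.real_smul, inv_mul_cancel_left₀]
  exact_mod_cast (by positivity : ((2 * Real.pi) ^ 4 : ℝ) ≠ 0)

/-- The partial derivative of a Schwartz function. -/
noncomputable def schwartzPd (l : Fin 4) (f : 𝓢(Spacetime, ℝ)) : 𝓢(Spacetime, ℝ) :=
  ∂_{(EuclideanSpace.single l (1 : ℝ) : Spacetime)} f

theorem schwartzPd_apply (l : Fin 4) (f : 𝓢(Spacetime, ℝ)) (x : Spacetime) :
    schwartzPd l f x = pd l f x :=
  SchwartzMap.lineDerivOp_apply_eq_fderiv _ f x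

theorem complexify_schwartzPd (l : Fin 4) (f : 𝓢(Spacetime, ℝ)) :
    complexify (schwartzPd l f) =
      ∂_{(EuclideanSpace.single l (1 : ℝ) : Spacetime)} (complexify f) := by
  ext x
  rw [complexify_apply, schwartzPd, SchwartzMap.lineDerivOp_apply_eq_fderiv,
    SchwartzMap.lineDerivOp_apply_eq_fderiv]
  have := (Complex.ofRealCLM.hasFDerivAt.comp x f.differentiableAt.hasFDerivAt).fderiv
  exact (congrArg (fun L => L (EuclideanSpace.single l (1 : ℝ))) this).symm

theorem fourier_schwartzPd (l : Fin 4) (f : 𝓢(Spacetime, ℝ)) (p : Spacetime) :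
    (p l : ℂ) * fourier f p = Complex.I * fourier (schwartzPd l f) p := by
  rw [fourier_eq_fourierTransform, fourier_eq_fourierTransform, complexify_schwartzPd,
    SchwartzMap.fourier_lineDerivOp_eq]
  have : (fun x : Spacetime =>
      inner ℝ x (EuclideanSpace.single l (1 : ℝ) : Spacetime)).HasTemperateGrowth :=
    ((innerSL ℝ).flip _).hasTemperateGrowth
  have hpi : (Real.pi : ℂ) ≠ 0 := by exact_mod_cast Real.pi_ne_zero
  have hin : inner ℝ ((-(2 * Real.pi)⁻¹) • p) (EuclideanSpace.single l (1 : ℝ) : Spacetime) =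
      -(2 * Real.pi)⁻¹ * p l := by
    rw [inner_smul_left, EuclideanSpace.inner_single_right]
    simp
  rw [smul_apply, SchwartzMap.smulLeftCLM_apply_apply this, hin]
  simp only [smul_eq_mul, Complex.real_smul]
  push_cast
  field_simp
  rw [Complex.I_sq]
  ring

theorem prod_conserved {m : ℕ} (f : Fin (m + 1) → 𝓢(Spacetime, ℝ)) (q : Fin m → Spacetime) :
    ∏ i, fourier (f i) (conserved q i) =
      fourier (f 0) (-∑ i, q i) * ∏ i, fourier (f i.succ) (q i) := by
  simp [conserved, Fin.prod_univ_succ]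

/-- The free momenta contribute an integrable product; the transform on leg `0`, whose momentum is
fixed by conservation, only has to be bounded. -/
theorem integrable_prod_fourier {m : ℕ} (f : Fin (m + 1) → 𝓢(Spacetime, ℝ)) :
    Integrable fun q : Fin m → Spacetime => ∏ i, fourier (f i) (conserved q i) := by
  simp only [prod_conserved]
  obtain ⟨C, hC⟩ := norm_fourier_le (f 0)
  have h1 : Integrable (fun q : Fin m → Spacetime => ∏ i, fourier (f i.succ) (q i)) :=
    Integrable.fintype_prod fun i => integrable_fourier _
  have h2 : Continuous fun q : Fin m → Spacetime => -∑ i, q i :=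
    (continuous_finsetSum _ fun i _ => continuous_apply i).neg
  exact h1.bdd_mul ((continuous_fourier (f 0)).comp h2).aestronglyMeasurable
    (Filter.Eventually.of_forall fun q => hC _)

theorem continuous_phase : Continuous fun z : Spacetime × Spacetime => phase z.1 z.2 := by
  simp only [phase, sum_mul_eq_inner]
  exact Complex.continuous_exp.comp (continuous_const.mul
    (Complex.continuous_ofReal.comp (continuous_snd.inner continuous_fst))).neg

theorem norm_phase (p x : Spacetime) : ‖phase p x‖ = 1 := by
  rw [phase, ← mul_neg, ← Complex.ofReal_neg, mul_comm Complex.I, Complex.norm_exp_ofReal_mul_I]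

/-- The integrand which interpolates between the position and the momentum space integral. -/
noncomputable def phaseIntegrand {m : ℕ} (f : Fin (m + 1) → 𝓢(Spacetime, ℝ)) (x : Spacetime)
    (q : Fin m → Spacetime) : ℂ :=
  (f 0 x : ℂ) * ∏ i, (phase (q i) x * fourier (f i.succ) (q i))

theorem continuous_phaseIntegrand {m : ℕ} (f : Fin (m + 1) → 𝓢(Spacetime, ℝ)) :
    Continuous (Function.uncurry (phaseIntegrand f)) := by
  refine (Complex.continuous_ofReal.comp ((f 0).continuous.comp continuous_fst)).mul ?_
  refine continuous_finsetProd _ fun i _ => ?_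
  have hi : Continuous fun z : Spacetime × (Fin m → Spacetime) => z.2 i :=
    (continuous_apply i).comp continuous_snd
  exact (continuous_phase.comp (hi.prodMk continuous_fst)).mul ((continuous_fourier _).comp hi)

theorem integrable_phaseIntegrand {m : ℕ} (f : Fin (m + 1) → 𝓢(Spacetime, ℝ)) :
    Integrable (Function.uncurry (phaseIntegrand f))
      ((volume : Measure Spacetime).prod (volume : Measure (Fin m → Spacetime))) := by
  have h2 : Integrable (fun q : Fin m → Spacetime => ∏ i, fourier (f i.succ) (q i)) :=
    Integrable.fintype_prod fun i => integrable_fourier _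
  have h3 : Integrable (fun x : Spacetime => (f 0 x : ℂ)) := (f 0).integrable.ofReal
  refine (h3.mul_prod h2).mono (continuous_phaseIntegrand f).aestronglyMeasurable
    (Filter.Eventually.of_forall fun z => ?_)
  simp only [Function.uncurry, phaseIntegrand, norm_mul, norm_prod, norm_phase, one_mul, le_refl]

theorem prod_eq_integral_phaseIntegrand {m : ℕ} (f : Fin (m + 1) → 𝓢(Spacetime, ℝ))
    (x : Spacetime) :
    ∏ i, (f i x : ℂ) =
      (((2 * Real.pi) ^ (4 * m) : ℝ) : ℂ)⁻¹ * ∫ q : Fin m → Spacetime, phaseIntegrand f x q := by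
  have h := integral_fintype_prod_volume_eq_prod (fun (i : Fin m) (q : Spacetime) =>
    phase q x * fourier (f i.succ) q)
  have h' : ∏ i : Fin m, (f i.succ x : ℂ) = (((2 * Real.pi) ^ (4 * m) : ℝ) : ℂ)⁻¹ *
      ∏ i : Fin m, ∫ q : Spacetime, phase q x * fourier (f i.succ) q := by
    rw [Finset.prod_congr rfl fun i _ => fourier_inversion (f i.succ) x,
      Finset.prod_mul_distrib, Finset.prod_const, Finset.card_univ, Fintype.card_fin, pow_mul]
    push_cast
    rw [inv_pow]
  rw [Fin.prod_univ_succ, h', ← h]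
  unfold phaseIntegrand
  rw [integral_const_mul, mul_left_comm]

theorem integral_phaseIntegrand {m : ℕ} (f : Fin (m + 1) → 𝓢(Spacetime, ℝ))
    (q : Fin m → Spacetime) :
    ∫ x : Spacetime, phaseIntegrand f x q = ∏ i, fourier (f i) (conserved q i) := by
  rw [prod_conserved]
  simp_rw [phaseIntegrand, Finset.prod_mul_distrib, ← mul_assoc]
  rw [integral_mul_const]
  congr 1
  unfold fourier phase
  congr 1
  ext x
  rw [mul_comm, ← Complex.exp_sum]
  congr 2
  have : ∑ μ, (-∑ i, q i) μ * x μ = -∑ i, ∑ μ, q i μ * x μ := by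
    rw [Finset.sum_comm]
    simp [Finset.sum_mul]
  rw [this, Finset.sum_neg_distrib, ← Finset.mul_sum, Complex.ofReal_neg, mul_neg,
    ← Complex.ofReal_sum]

/-- Fubini for `phaseIntegrand`: the `q`-integral inverts the transforms on the legs `1, …, m`,
while the `x`-integral collects the phases into the transform of `f 0` at `-∑ qᵢ`. No distribution
enters. -/
theorem deltaIntegral_prod_fourier {m : ℕ} (f : Fin (m + 1) → 𝓢(Spacetime, ℝ)) :
    deltaIntegral m (fun p => ∏ i, fourier (f i) (p i)) = ∫ x, ∏ i, (f i x : ℂ) := by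
  simp_rw [prod_eq_integral_phaseIntegrand]
  rw [integral_const_mul, deltaIntegral]
  congr 1
  rw [integral_integral_swap (integrable_phaseIntegrand f)]
  simp_rw [integral_phaseIntegrand]

end FourierAnalysis

/-! ### Holomorphic square roots and Cauchy estimates in one variable. -/

section OneVariable

open Metric

/-- On a disc `f'/f` has a primitive `L` with `L 0 = 0`. Since `f e^{-L}` has derivative zero and
value `1` at `0`, `L` is a logarithm of `f`, and `e^{L/2}` is the root. -/
theorem exists_holomorphic_sqrt {R : ℝ} (hR : 0 < R) {f : ℂ → ℂ}
    (hf : DifferentiableOn ℂ f (ball 0 R)) (hne : ∀ z ∈ ball (0 : ℂ) R, f z ≠ 0) (h0 : f 0 = 1) :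
    ∃ S : ℂ → ℂ, DifferentiableOn ℂ S (ball 0 R) ∧ S 0 = 1 ∧
      ∀ z ∈ ball (0 : ℂ) R, S z ^ 2 = f z := by
  obtain ⟨L, hL0, hL⟩ := (((hf.deriv isOpen_ball).div hf hne).isExactOn_ball).with_val_at 0 0
  have hLd : DifferentiableOn ℂ L (ball 0 R) := fun z hz =>
    (hL z hz).differentiableAt.differentiableWithinAt
  refine ⟨fun z => Complex.exp (L z / 2), (hLd.div_const 2).cexp, by simp [hL0], fun z hz => ?_⟩
  have hd : ∀ w ∈ ball (0 : ℂ) R,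
      HasDerivAt (fun w => f w * Complex.exp (-L w)) 0 w := by
    intro w hw
    have h1 := ((hf w hw).differentiableAt (isOpen_ball.mem_nhds hw)).hasDerivAt
    have h2 := h1.mul (hL w hw).neg.cexp
    refine h2.congr_deriv ?_
    have := hne w hw
    simp only [Pi.div_apply]
    field_simp
    ring
  have hc := isOpen_ball.is_const_of_deriv_eq_zero (convex_ball (0 : ℂ) R).isPreconnected
    (fun w hw => (hd w hw).differentiableAt.differentiableWithinAt)
    (fun w hw => (hd w hw).deriv) hz (mem_ball_self hR)
  simp only [h0, hL0, neg_zero, Complex.exp_zero, mul_one] at hc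
  rw [← Complex.exp_nat_mul]
  have : ((2 : ℕ) : ℂ) * (L z / 2) = L z := by push_cast; ring
  rw [this]
  rw [Complex.exp_neg, ← div_eq_mul_inv, div_eq_one_iff_eq (Complex.exp_ne_zero _)] at hc
  exact hc.symm

/-- A real power series which represents a holomorphic function near zero has the coefficients
of this function. -/
theorem taylor_coeff_eq {R : ℝ} (hR : 0 < R) {F : ℂ → ℂ} (hF : DifferentiableOn ℂ F (ball 0 R))
    {a : ℕ → ℝ} {f : ℝ → ℝ} (hf : ∀ᶠ t in nhds (0 : ℝ), HasSum (fun n => t ^ n * a n) (f t))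
    (hfF : ∀ᶠ t : ℝ in nhds 0, F t = f t) (n : ℕ) :
    (a n : ℂ) = (n.factorial : ℂ)⁻¹ * iteratedDeriv n F 0 := by
  set p : (ℕ → ℂ) → FormalMultilinearSeries ℝ ℝ ℂ := fun c n =>
    ContinuousMultilinearMap.mkPiRing ℝ (Fin n) (c n) with hp
  have hcoeff : ∀ c n, (p c).coeff n = c n := by
    intro c n
    simp [hp, FormalMultilinearSeries.coeff]
  have h1 : HasFPowerSeriesAt (fun t : ℝ => F t) (p fun n => (a n : ℂ)) 0 := by
    rw [hasFPowerSeriesAt_iff]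
    filter_upwards [hf, hfF] with t ht1 ht2
    simp only [hcoeff, zero_add, ht2]
    have := Complex.hasSum_ofReal.2 ht1
    simpa using this
  have h2 : HasFPowerSeriesAt (fun t : ℝ => F t)
      (p fun n => (n.factorial : ℂ)⁻¹ * iteratedDeriv n F 0) 0 := by
    rw [hasFPowerSeriesAt_iff]
    filter_upwards [ball_mem_nhds (0 : ℝ) hR] with t ht
    simp only [hcoeff, zero_add]
    have := Complex.hasSum_taylorSeries_on_ball hF (z := (t : ℂ)) (by simpa using ht)
    convert this using 2 with n
    simp only [sub_zero, smul_eq_mul, Complex.real_smul, Complex.ofReal_pow]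
    ring
  have h3 := congrArg (fun q => q.coeff n) (h1.eq_formalMultilinearSeries h2)
  simpa only [hcoeff] using h3

/-- The real series is known to converge only near `0`. The holomorphic extension carries it to `t =
1 < R`, and Cauchy's estimate on the circle of radius `s` gives geometric decay of the coefficients.
-/
theorem taylor_coeff_bound {R s M : ℝ} (hs1 : 1 < s) (hsR : s < R) {F : ℂ → ℂ}
    (hF : DifferentiableOn ℂ F (ball 0 R)) (hM : ∀ z ∈ closedBall (0 : ℂ) s, ‖F z‖ ≤ M)
    {a : ℕ → ℝ} {f : ℝ → ℝ} (hf : ∀ᶠ t in nhds (0 : ℝ), HasSum (fun n => t ^ n * a n) (f t))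
    (hfF : ∀ t : ℝ, t ∈ Set.Ioo (-R) R → F t = f t) :
    (∀ n, |a n| ≤ M * s⁻¹ ^ n) ∧ HasSum a (f 1) := by
  have hs0 : 0 < s := by linarith
  have hR0 : 0 < R := by linarith
  have hnear : ∀ᶠ t : ℝ in nhds 0, F t = f t :=
    Filter.eventually_of_mem (Ioo_mem_nhds (by linarith) hR0) hfF
  have hc := taylor_coeff_eq hR0 hF hf hnear
  constructor
  · intro n
    have h1 := Complex.norm_iteratedDeriv_le_of_forall_mem_sphere_norm_le (f := F) (c := 0) n hs0
      (hF.mono (closure_ball_subset_closedBall.trans (closedBall_subset_ball hsR))).diffContOnCl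
      (fun z hz => hM z (sphere_subset_closedBall hz))
    have h2 : |a n| = ‖(a n : ℂ)‖ := by simp
    have hn : (0 : ℝ) < n.factorial := by exact_mod_cast n.factorial_pos
    rw [h2, hc n, norm_mul, norm_inv, Complex.norm_natCast]
    calc (n.factorial : ℝ)⁻¹ * ‖iteratedDeriv n F 0‖
        ≤ (n.factorial : ℝ)⁻¹ * (n.factorial * M / s ^ n) := by gcongr
      _ = M * s⁻¹ ^ n := by rw [inv_pow]; field_simp
  · have h1 := Complex.hasSum_taylorSeries_on_ball hF (z := ((1 : ℝ) : ℂ))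
      (by simp; linarith)
    rw [hfF 1 ⟨by linarith, by linarith⟩] at h1
    rw [← Complex.hasSum_ofReal]
    have h2 : (fun n => (a n : ℂ)) = fun n : ℕ => ((n.factorial : ℝ) : ℂ)⁻¹ •
        ((((1 : ℝ) : ℂ) - 0) ^ n • iteratedDeriv n F 0) := by
      funext n
      rw [hc n]
      simp
    rw [h2]
    simpa using h1

end OneVariable

/-! ### Smooth dependence of determinant, inverse and volume factor on the matrix entries. -/

section Smoothness

variable {𝕜 E : Type*} [NontriviallyNormedField 𝕜] [NormedAddCommGroup E] [NormedSpace 𝕜 E]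
  {n : WithTop ℕ∞} {x : E}

/-- The field is left general because the determinant and inverse lemmas serve twice: over `ℝ` for
the regularity of the metric and over `ℂ` for holomorphy along `z ↦ η + z H`. -/
theorem contDiffAt_det {M : E → Matrix (Fin 4) (Fin 4) 𝕜}
    (hM : ∀ i j, ContDiffAt 𝕜 n (fun y => M y i j) x) :
    ContDiffAt 𝕜 n (fun y => (M y).det) x := by
  simp only [Matrix.det_apply']
  exact ContDiffAt.sum fun σ _ => contDiffAt_const.mul (contDiffAt_prod fun i _ => hM _ _)

theorem contDiffAt_adjugate {M : E → Matrix (Fin 4) (Fin 4) 𝕜}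
    (hM : ∀ i j, ContDiffAt 𝕜 n (fun y => M y i j) x) (i j : Fin 4) :
    ContDiffAt 𝕜 n (fun y => (M y).adjugate i j) x := by
  simp only [Matrix.adjugate_apply]
  refine contDiffAt_det fun k l => ?_
  by_cases hk : k = j
  · subst hk
    simpa using contDiffAt_const
  · simpa [Matrix.updateRow_ne hk] using hM k l

theorem inv_apply_eq (M : Matrix (Fin 4) (Fin 4) 𝕜) (i j : Fin 4) :
    M⁻¹ i j = M.det⁻¹ * M.adjugate i j := by
  rw [Matrix.inv_def, Ring.inverse_eq_inv', Matrix.smul_apply, smul_eq_mul]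

theorem contDiffAt_matrix_inv {M : E → Matrix (Fin 4) (Fin 4) 𝕜}
    (hM : ∀ i j, ContDiffAt 𝕜 n (fun y => M y i j) x) (h0 : (M x).det ≠ 0) (i j : Fin 4) :
    ContDiffAt 𝕜 n (fun y => (M y)⁻¹ i j) x := by
  simp only [inv_apply_eq]
  exact ((contDiffAt_det hM).inv h0).mul (contDiffAt_adjugate hM i j)

theorem contDiffAt_volumeFactor {E : Type*} [NormedAddCommGroup E] [NormedSpace ℝ E] {x : E}
    {M : E → Matrix (Fin 4) (Fin 4) ℝ}
    (hM : ∀ i j, ContDiffAt ℝ n (fun y => M y i j) x) (h0 : (M x).det ≠ 0) :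
    ContDiffAt ℝ n (fun y => volumeFactor (M y)) x :=
  (contDiffAt_det hM).neg.sqrt (neg_ne_zero.2 h0)

end Smoothness

/-! ### Uniform Taylor expansion of `√(-g) g⁻¹ g⁻¹ g⁻¹` around the Minkowski metric. -/

section MatrixExpansion

open Metric

/-- The values of a tensor field with two lower indices. -/
abbrev TensorValue : Type := Fin 4 → Fin 4 → ℝ

/-- The complexified metric `η + z H`. -/
noncomputable def complexMetric (H : TensorValue) (z : ℂ) : Matrix (Fin 4) (Fin 4) ℂ :=
  Matrix.of fun i j => (eta i j : ℂ) + z * (H i j : ℂ)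

/-- `η + z H` is invertible for all complex `z` in the closed unit disc. -/
def Nondegenerate (H : TensorValue) : Prop :=
  ∀ z : ℂ, ‖z‖ ≤ 1 → (complexMetric H z).det ≠ 0

theorem continuous_complexMetric :
    Continuous fun w : TensorValue × ℂ => complexMetric w.1 w.2 := by
  refine continuous_matrix fun i j => ?_
  have : Continuous fun w : TensorValue × ℂ => w.1 i j :=
    (continuous_apply_apply i j).comp continuous_fst
  exact continuous_const.add (continuous_snd.mul (Complex.continuous_ofReal.comp this))

theorem continuous_det_complexMetric :
    Continuous fun w : TensorValue × ℂ => (complexMetric w.1 w.2).det :=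
  continuous_complexMetric.matrix_det

theorem eta_det : eta.det = -1 := by
  simp [eta, Matrix.det_diagonal, Fin.prod_univ_four]

theorem eta_mul_eta : eta * eta = 1 := by
  rw [eta, Matrix.diagonal_mul_diagonal, ← Matrix.diagonal_one]
  congr 1
  ext i
  fin_cases i <;> simp

theorem complexMetric_ofReal (H : TensorValue) (t : ℝ) :
    complexMetric H t = (eta + Matrix.of (t • H)).map (algebraMap ℝ ℂ) := by
  ext i j
  simp [complexMetric]

theorem det_map_ofReal (M : Matrix (Fin 4) (Fin 4) ℝ) :
    (M.map (algebraMap ℝ ℂ)).det = (M.det : ℂ) :=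
  (RingHom.map_det (algebraMap ℝ ℂ) M).symm

theorem inv_map_ofReal (M : Matrix (Fin 4) (Fin 4) ℝ) (i j : Fin 4) :
    (M.map (algebraMap ℝ ℂ))⁻¹ i j = ((M⁻¹ i j : ℝ) : ℂ) := by
  have h := congrFun (congrFun (RingHom.map_adjugate (algebraMap ℝ ℂ) M) i) j
  rw [inv_apply_eq, inv_apply_eq, det_map_ofReal]
  push_cast
  congr 1
  exact h.symm

theorem complexMetric_zero_right (H : TensorValue) :
    complexMetric H 0 = eta.map (algebraMap ℝ ℂ) := by
  ext i j
  simp [complexMetric]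

theorem det_complexMetric_zero_right (H : TensorValue) : (complexMetric H 0).det = -1 := by
  rw [complexMetric_zero_right, det_map_ofReal, eta_det]
  simp

theorem complexMetric_zero_left (z : ℂ) :
    complexMetric 0 z = eta.map (algebraMap ℝ ℂ) := by
  ext i j
  simp [complexMetric]

theorem nondegenerate_zero : Nondegenerate 0 := by
  intro z _
  rw [complexMetric_zero_left, det_map_ofReal, eta_det]
  simp

/-- If all eigenvalues of `η H` have modulus less than one, then `η + z H` is invertible on the
closed unit disc. -/
theorem nondegenerate_of_spectrum {H : TensorValue}
    (h : ∀ z ∈ spectrum ℂ ((eta * Matrix.of H).map (algebraMap ℝ ℂ)), ‖z‖ < 1) :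
    Nondegenerate H := by
  intro z hz h0
  have hz0 : z ≠ 0 := by
    rintro rfl
    rw [det_complexMetric_zero_right] at h0
    norm_num at h0
  have hmem : -z⁻¹ ∈ spectrum ℂ ((eta * Matrix.of H).map (algebraMap ℝ ℂ)) := by
    rw [spectrum.mem_iff, Matrix.isUnit_iff_isUnit_det, isUnit_iff_ne_zero, not_not]
    -- As `η² = 1`, `η + z H = -z η (-z⁻¹ - η H)`: a zero of the determinant makes `-z⁻¹`, of
    -- modulus at least one, an eigenvalue of `η H`.
    have hfac : complexMetric H z = (-z) • (eta.map (algebraMap ℝ ℂ) *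
        (algebraMap ℂ (Matrix (Fin 4) (Fin 4) ℂ) (-z⁻¹) -
          (eta * Matrix.of H).map (algebraMap ℝ ℂ))) := by
      rw [mul_sub, ← Matrix.map_mul, ← mul_assoc, eta_mul_eta, one_mul,
        Algebra.algebraMap_eq_smul_one,
        mul_smul_comm, mul_one]
      ext i j
      simp [complexMetric]
      field_simp
      ring
    rw [hfac, Matrix.det_smul, Matrix.det_mul, det_map_ofReal, eta_det] at h0
    simpa [hz0] using h0
  have := h _ hmem
  rw [norm_neg, norm_inv] at this
  have hpos : 0 < ‖z‖ := norm_pos_iff.2 hz0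
  exact absurd (one_le_inv₀ hpos |>.2 hz) (not_le.2 this)

/-- The pairs `(H, z)` for which `η + z H` is invertible. -/
def nondegenerateSet : Set (TensorValue × ℂ) := {w | (complexMetric w.1 w.2).det ≠ 0}

theorem mem_nondegenerateSet (w : TensorValue × ℂ) :
    w ∈ nondegenerateSet ↔ (complexMetric w.1 w.2).det ≠ 0 := Iff.rfl

theorem isOpen_nondegenerateSet : IsOpen nondegenerateSet :=
  isOpen_compl_singleton.preimage continuous_det_complexMetric

theorem prod_closedBall_subset {K : Set TensorValue} (hnd : ∀ H ∈ K, Nondegenerate H) :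
    K ×ˢ closedBall (0 : ℂ) 1 ⊆ nondegenerateSet := fun w hw =>
  (mem_nondegenerateSet w).2 (hnd w.1 hw.1 w.2 (mem_closedBall_zero_iff.1 hw.2))

theorem eventually_nondegenerate : ∀ᶠ H in nhds (0 : TensorValue), Nondegenerate H := by
  obtain ⟨u, v, hu, -, h0u, hv, huv⟩ := generalized_tube_lemma
    (isCompact_singleton (x := (0 : TensorValue))) (isCompact_closedBall (0 : ℂ) 1)
    isOpen_nondegenerateSet (prod_closedBall_subset fun H hH => by
      rw [Set.mem_singleton_iff.1 hH]
      exact nondegenerate_zero)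
  filter_upwards [hu.mem_nhds (h0u rfl)] with H hH z hz
  exact (mem_nondegenerateSet (H, z)).1
    (huv (Set.mk_mem_prod hH (hv (mem_closedBall_zero_iff.2 hz))))

/-- Invertibility is an open condition on `(H, z)`, so by the tube lemma it extends from `K` times
the closed unit disc to `K` times a thickening of that disc. One radius beyond `1` thus works for
all of `K`. -/
theorem exists_radius {K : Set TensorValue} (hK : IsCompact K) (hnd : ∀ H ∈ K, Nondegenerate H) :
    ∃ R : ℝ, 1 < R ∧ ∀ H ∈ K, ∀ z : ℂ, ‖z‖ < R → (complexMetric H z).det ≠ 0 := by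
  obtain ⟨u, v, -, hv, hKu, hBv, huv⟩ := generalized_tube_lemma hK
    (isCompact_closedBall (0 : ℂ) 1) isOpen_nondegenerateSet (prod_closedBall_subset hnd)
  obtain ⟨δ, hδ, hsub⟩ := (isCompact_closedBall (0 : ℂ) 1).exists_thickening_subset_open hv hBv
  rw [thickening_closedBall hδ zero_le_one] at hsub
  refine ⟨δ + 1, by linarith, fun H hH z hz => (mem_nondegenerateSet (H, z)).1 (huv
    (Set.mk_mem_prod (hKu hH) (hsub (mem_ball_zero_iff.2 hz))))⟩

/-- Along `t ↦ η + t H`, `0 ≤ t ≤ 1`, the determinant never vanishes, and it starts at `-1`. -/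
theorem Nondegenerate.neg_det_pos {H : TensorValue} (hH : Nondegenerate H) :
    0 < -(eta + Matrix.of H).det := by
  have hcont : Continuous fun t : ℝ => -(eta + Matrix.of (t • H)).det := by
    refine (Continuous.matrix_det (continuous_matrix fun i j => ?_)).neg
    simp only [Matrix.add_apply, Matrix.of_apply, Pi.smul_apply, smul_eq_mul]
    fun_prop
  have hne : ∀ t ∈ Set.Icc (0 : ℝ) 1, -(eta + Matrix.of (t • H)).det ≠ 0 := by
    intro t ht h0
    refine hH t (by simpa [abs_of_nonneg ht.1] using ht.2) ?_
    rw [complexMetric_ofReal, det_map_ofReal, neg_eq_zero.1 h0, Complex.ofReal_zero]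
  by_contra hcon
  have h1 : -(eta + Matrix.of ((1 : ℝ) • H)).det ≤ 0 := by simpa using hcon
  have h0 : 0 ≤ -(eta + Matrix.of ((0 : ℝ) • H)).det := by
    rw [zero_smul, Matrix.of_zero, add_zero, eta_det]
    norm_num
  obtain ⟨t, ht, ht0⟩ := intermediate_value_Icc' zero_le_one hcont.continuousOn ⟨h1, h0⟩
  exact hne t ht ht0

theorem Nondegenerate.det_ne_zero {H : TensorValue} (hH : Nondegenerate H) :
    (eta + Matrix.of H).det ≠ 0 := by
  have := hH.neg_det_pos
  intro h
  rw [h] at this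
  simp at this

theorem contDiffAt_metric_entry {n : WithTop ℕ∞} {H₀ : TensorValue} (i j : Fin 4) :
    ContDiffAt ℝ n (fun H : TensorValue => (eta + Matrix.of H) i j) H₀ := by
  simp only [Matrix.add_apply, Matrix.of_apply]
  exact contDiffAt_const.add (by fun_prop)

theorem contDiffAt_volumeInvInvInv {n : WithTop ℕ∞} {H₀ : TensorValue}
    (h0 : (eta + Matrix.of H₀).det ≠ 0) (μ ν α β ρ σ : Fin 4) :
    ContDiffAt ℝ n (volumeInvInvInv μ ν α β ρ σ) H₀ := by
  have hi := contDiffAt_matrix_inv (𝕜 := ℝ) (n := n) (x := H₀)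
    (M := fun H : TensorValue => eta + Matrix.of H) contDiffAt_metric_entry h0
  exact (((contDiffAt_volumeFactor contDiffAt_metric_entry h0).mul (hi μ ν)).mul (hi α β)).mul
    (hi ρ σ)

theorem analyticAt_volumeInvInvInv (μ ν α β ρ σ : Fin 4) :
    AnalyticAt ℝ (volumeInvInvInv μ ν α β ρ σ) 0 :=
  ContDiffAt.analyticAt (contDiffAt_volumeInvInvInv nondegenerate_zero.det_ne_zero μ ν α β ρ σ)

/-- The homogeneous part of degree `n` of the Taylor series at zero of a function of a tensor. -/
noncomputable def taylorTerm (X : TensorValue → ℝ) (n : ℕ) (H : TensorValue) : ℝ :=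
  (n.factorial : ℝ)⁻¹ * iteratedFDeriv ℝ n X 0 fun _ => H

/-- Analyticity at `0` yields the expansion only for small `t`; reaching `t = 1` needs the
complexification below. -/
theorem hasSum_taylorTerm_line {X : TensorValue → ℝ} (hX : AnalyticAt ℝ X 0) (H : TensorValue) :
    ∀ᶠ t in nhds (0 : ℝ), HasSum (fun n => t ^ n * taylorTerm X n H) (X (t • H)) := by
  obtain ⟨p, r, hp⟩ := hX
  have hlim : Filter.Tendsto (fun t : ℝ => t • H) (nhds 0) (nhds 0) := by
    have : Continuous fun t : ℝ => t • H := by fun_prop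
    simpa using this.tendsto 0
  filter_upwards [hlim (eball_mem_nhds (0 : TensorValue) hp.r_pos)] with t ht
  have := hp.hasSum_iteratedFDeriv ht
  rw [zero_add] at this
  have h1 : (fun n : ℕ => t ^ n * taylorTerm X n H) =
      fun n : ℕ => (n.factorial : ℝ)⁻¹ • iteratedFDeriv ℝ n X 0 fun _ => t • H := by
    funext n
    have h2 := (iteratedFDeriv ℝ n X 0).map_smul_univ (fun _ => t) (fun _ => H)
    simp only [Finset.prod_const, Finset.card_univ, Fintype.card_fin, smul_eq_mul] at h2
    rw [smul_eq_mul, h2, taylorTerm, mul_left_comm]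
  rw [h1]
  exact this

/-- The complexification of `√(-g) g^{μν} g^{αβ} g^{ρσ}` along a line. -/
theorem exists_complexification {R : ℝ} (hR : 0 < R) {H : TensorValue}
    (hne : ∀ z : ℂ, ‖z‖ < R → (complexMetric H z).det ≠ 0) (μ ν α β ρ σ : Fin 4) :
    ∃ F : ℂ → ℂ, DifferentiableOn ℂ F (ball 0 R) ∧
      (∀ z ∈ ball (0 : ℂ) R, ‖F z‖ = Real.sqrt ‖(complexMetric H z).det‖ *
        ‖(complexMetric H z)⁻¹ μ ν‖ * ‖(complexMetric H z)⁻¹ α β‖ *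
          ‖(complexMetric H z)⁻¹ ρ σ‖) ∧
      ∀ t : ℝ, t ∈ Set.Ioo (-R) R → F t = volumeInvInvInv μ ν α β ρ σ (t • H) := by
  have hentry : ∀ (z : ℂ) (i j : Fin 4), ContDiffAt ℂ 1 (fun z => complexMetric H z i j) z := by
    intro z i j
    exact contDiffAt_const.add (contDiffAt_id.mul contDiffAt_const)
  have hball : ∀ z ∈ ball (0 : ℂ) R, (complexMetric H z).det ≠ 0 := fun z hz =>
    hne z (by simpa using hz)
  have hdet : DifferentiableOn ℂ (fun z => -(complexMetric H z).det) (ball 0 R) := fun z _ =>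
    ((contDiffAt_det (hentry z)).neg.differentiableAt one_ne_zero).differentiableWithinAt
  have hinv : ∀ i j, DifferentiableOn ℂ (fun z => (complexMetric H z)⁻¹ i j) (ball 0 R) :=
    fun i j z hz => ((contDiffAt_matrix_inv (hentry z) (hball z hz) i j).differentiableAt
      one_ne_zero).differentiableWithinAt
  obtain ⟨S, hSd, hS0, hS⟩ := exists_holomorphic_sqrt hR hdet
    (fun z hz => neg_ne_zero.2 (hball z hz)) (by simp [det_complexMetric_zero_right])
  have hSreal : ∀ t : ℝ, t ∈ Set.Ioo (-R) R →
      S t = (volumeFactor (eta + Matrix.of (t • H)) : ℂ) := by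
    have hmem : ∀ t : ℝ, t ∈ Set.Ioo (-R) R → (t : ℂ) ∈ ball (0 : ℂ) R := by
      intro t ht
      simpa [abs_lt] using ht
    have hcont : Continuous fun t : ℝ => -(eta + Matrix.of (t • H)).det := by
      refine (Continuous.matrix_det (continuous_matrix fun i j => ?_)).neg
      simp only [Matrix.add_apply, Matrix.of_apply, Pi.smul_apply, smul_eq_mul]
      fun_prop
    have hD : ∀ t : ℝ, -(complexMetric H t).det = ((-(eta + Matrix.of (t • H)).det : ℝ) : ℂ) := by
      intro t
      rw [complexMetric_ofReal, det_map_ofReal, Complex.ofReal_neg]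
    have hpos : ∀ t ∈ Set.Ioo (-R) R, 0 < -(eta + Matrix.of (t • H)).det := by
      intro t ht
      have h0 : (0 : ℝ) ∈ Set.Ioo (-R) R := ⟨by linarith, hR⟩
      by_contra hcon
      obtain ⟨s, hs, hs0⟩ := isPreconnected_Ioo.intermediate_value ht h0 hcont.continuousOn
        (⟨not_lt.1 hcon, by simp [eta_det]⟩ :
          (0 : ℝ) ∈ Set.Icc (-(eta + Matrix.of (t • H)).det)
            (-(eta + Matrix.of ((0 : ℝ) • H)).det))
      have h1 := hD s
      rw [show -(eta + Matrix.of (s • H)).det = 0 from hs0, Complex.ofReal_zero, neg_eq_zero] at h1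
      exact hball s (hmem s hs) h1
    -- The holomorphic root and the positive real root have the same square and agree at `0`; the
    -- latter has no zero on the interval, so by connectedness they coincide.
    have key := isPreconnected_Ioo.eq_of_sq_eq (S := Set.Ioo (-R) R) (f := fun t : ℝ => S t)
      (g := fun t : ℝ => (volumeFactor (eta + Matrix.of (t • H)) : ℂ))
      (hSd.continuousOn.comp Complex.continuous_ofReal.continuousOn hmem)
      ((Complex.continuous_ofReal.comp (Real.continuous_sqrt.comp hcont)).continuousOn)
      (fun t ht => by
        simp only [Pi.pow_apply]
        rw [hS _ (hmem t ht), hD, ← Complex.ofReal_pow, volumeFactor,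
          Real.sq_sqrt (hpos t ht).le])
      (fun {t} ht => by
        have := (Real.sqrt_pos.2 (hpos t ht)).ne'
        exact_mod_cast this)
      (y := 0) ⟨by linarith, hR⟩ (by simp [hS0, volumeFactor, eta_det])
    exact fun t ht => key ht
  refine ⟨fun z => S z * (complexMetric H z)⁻¹ μ ν * (complexMetric H z)⁻¹ α β *
    (complexMetric H z)⁻¹ ρ σ, ((hSd.mul (hinv μ ν)).mul (hinv α β)).mul (hinv ρ σ), ?_, ?_⟩
  · intro z hz
    rw [norm_mul, norm_mul, norm_mul, ← norm_neg (complexMetric H z).det, ← hS z hz, norm_pow,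
      Real.sqrt_sq (norm_nonneg _)]
  · intro t ht
    simp only [hSreal t ht, complexMetric_ofReal, inv_map_ofReal, volumeInvInvInv,
      Complex.ofReal_mul]

/-- The holomorphic root is chosen separately for each `H`, with no continuity in `H`. Its modulus
is `√‖det‖`, which is jointly continuous in `(H, z)`, so compactness still gives a bound uniform in
`H`. -/
theorem exists_bound_complexMetric {K : Set TensorValue} (hK : IsCompact K) {s : ℝ}
    (hs : ∀ H ∈ K, ∀ z : ℂ, ‖z‖ ≤ s → (complexMetric H z).det ≠ 0) (μ ν α β ρ σ : Fin 4) :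
    ∃ M, ∀ H ∈ K, ∀ z : ℂ, ‖z‖ ≤ s → Real.sqrt ‖(complexMetric H z).det‖ *
      ‖(complexMetric H z)⁻¹ μ ν‖ * ‖(complexMetric H z)⁻¹ α β‖ *
        ‖(complexMetric H z)⁻¹ ρ σ‖ ≤ M := by
  have hinv : ∀ i j, ContinuousOn (fun w : TensorValue × ℂ => ‖(complexMetric w.1 w.2)⁻¹ i j‖)
      (K ×ˢ closedBall 0 s) := by
    intro i j
    simp only [inv_apply_eq]
    refine ((continuous_det_complexMetric.continuousOn.inv₀ fun w hw => ?_).mul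
      (continuous_complexMetric.matrix_adjugate.matrix_elem i j).continuousOn).norm
    exact hs w.1 hw.1 w.2 (by simpa using hw.2)
  have hsq : ContinuousOn (fun w : TensorValue × ℂ => Real.sqrt ‖(complexMetric w.1 w.2).det‖)
      (K ×ˢ closedBall 0 s) :=
    (Real.continuous_sqrt.comp continuous_det_complexMetric.norm).continuousOn
  obtain ⟨M, hM⟩ := (hK.prod (isCompact_closedBall (0 : ℂ) s)).exists_bound_of_continuousOn
    (((hsq.mul (hinv μ ν)).mul (hinv α β)).mul (hinv ρ σ))
  refine ⟨M, fun H hH z hz => (le_abs_self _).trans (hM (H, z) ⟨hH, by simpa using hz⟩)⟩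

/-- Uniform geometric bounds for the Taylor series of `√(-g) g^{μν} g^{αβ} g^{ρσ}`. -/
theorem exists_taylorTerm_bound {K : Set TensorValue} (hK : IsCompact K)
    (hnd : ∀ H ∈ K, Nondegenerate H) :
    ∃ s : ℝ, 1 < s ∧ ∀ μ ν α β ρ σ, ∃ M : ℝ, ∀ H ∈ K,
      (∀ n, |taylorTerm (volumeInvInvInv μ ν α β ρ σ) n H| ≤ M * s⁻¹ ^ n) ∧
      HasSum (fun n => taylorTerm (volumeInvInvInv μ ν α β ρ σ) n H)
        (volumeInvInvInv μ ν α β ρ σ H) := by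
  obtain ⟨R, hR1, hR⟩ := exists_radius hK hnd
  -- The midpoint of `1` and `R`: the Cauchy circle stays inside the disc of holomorphy, and the
  -- ratio `s⁻¹` is less than one.
  have hs1 : 1 < (1 + R) / 2 := by linarith
  have hsR : (1 + R) / 2 < R := by linarith
  refine ⟨(1 + R) / 2, hs1, fun μ ν α β ρ σ => ?_⟩
  obtain ⟨M, hM⟩ := exists_bound_complexMetric hK
    (fun H hH z hz => hR H hH z (hz.trans_lt hsR)) μ ν α β ρ σ
  refine ⟨M, fun H hH => ?_⟩
  obtain ⟨F, hFd, hFn, hFr⟩ := exists_complexification (by linarith) (hR H hH) μ ν α β ρ σ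
  have := taylor_coeff_bound (f := fun t => volumeInvInvInv μ ν α β ρ σ (t • H)) hs1 hsR hFd
    (M := M) (fun z hz => by
      rw [hFn z (closedBall_subset_ball hsR hz)]
      exact hM H hH z (by simpa using hz))
    (hasSum_taylorTerm_line (analyticAt_volumeInvInvInv μ ν α β ρ σ) H) hFr
  simpa using this

end MatrixExpansion

/-! ### Rules for partial derivatives and Jacobi's formula. -/

section PartialDerivatives

variable {f k : Spacetime → ℝ} {x : Spacetime}

theorem pd_add (l : Fin 4) (hf : DifferentiableAt ℝ f x) (hk : DifferentiableAt ℝ k x) :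
    pd l (fun y => f y + k y) x = pd l f x + pd l k x := by
  simp [pd, fderiv_fun_add hf hk]

theorem pd_sub (l : Fin 4) (hf : DifferentiableAt ℝ f x) (hk : DifferentiableAt ℝ k x) :
    pd l (fun y => f y - k y) x = pd l f x - pd l k x := by
  simp [pd, fderiv_fun_sub hf hk]

theorem pd_mul (l : Fin 4) (hf : DifferentiableAt ℝ f x) (hk : DifferentiableAt ℝ k x) :
    pd l (fun y => f y * k y) x = pd l f x * k x + f x * pd l k x := by
  simp [pd, fderiv_fun_mul hf hk]
  ring

theorem pd_const (l : Fin 4) (c : ℝ) (x : Spacetime) : pd l (fun _ => c) x = 0 := by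
  simp [pd]

theorem pd_const_mul (l : Fin 4) (c : ℝ) (hf : DifferentiableAt ℝ f x) :
    pd l (fun y => c * f y) x = c * pd l f x := by
  rw [pd_mul l (differentiableAt_const c) hf, pd_const, zero_mul, zero_add]

theorem pd_sum {ι : Type*} (l : Fin 4) (s : Finset ι) {F : ι → Spacetime → ℝ}
    (hF : ∀ i ∈ s, DifferentiableAt ℝ (F i) x) :
    pd l (fun y => ∑ i ∈ s, F i y) x = ∑ i ∈ s, pd l (F i) x := by
  simp [pd, fderiv_fun_sum hF]

theorem contDiff_pd {n : ℕ} (l : Fin 4) (hf : ContDiff ℝ (n + 1) f) : ContDiff ℝ n (pd l f) :=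
  (hf.fderiv_right le_rfl).clm_apply contDiff_const

/-- Jacobi's formula for the derivative of a determinant. -/
theorem pd_det (l : Fin 4) {g : Spacetime → Matrix (Fin 4) (Fin 4) ℝ}
    (hg : ∀ i j, DifferentiableAt ℝ (fun y => g y i j) x) :
    pd l (fun y => (g y).det) x =
      ∑ i, ∑ j, (g x).adjugate i j * pd l (fun y => g y j i) x := by
  have h1 : ∀ i, ∑ j, (g x).adjugate i j * pd l (fun y => g y j i) x =
      ∑ σ : Equiv.Perm (Fin 4), (Equiv.Perm.sign σ : ℝ) *
        ((∏ j ∈ Finset.univ.erase i, g x (σ j) j) * pd l (fun y => g y (σ i) i) x) := by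
    intro i
    -- By Cramer's rule, the adjugate applied to the differentiated column `i` is the determinant
    -- with that column replaced, which the Leibniz formula expands.
    have := congrFun (Matrix.cramer_eq_adjugate_mulVec (g x)
      (fun j => pd l (fun y => g y j i) x)) i
    rw [Matrix.cramer_apply, Matrix.det_apply'] at this
    refine this.symm.trans (Finset.sum_congr rfl fun σ _ => ?_)
    rw [← Finset.prod_erase_mul _ _ (Finset.mem_univ i)]
    congr 2
    · refine Finset.prod_congr rfl fun j hj => ?_
      rw [Matrix.updateCol_ne (Finset.ne_of_mem_erase hj)]
    · rw [Matrix.updateCol_self]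
  have hprod : ∀ σ : Equiv.Perm (Fin 4),
      DifferentiableAt ℝ (fun y => ∏ i, g y (σ i) i) x := fun σ =>
    (HasFDerivAt.finsetProd fun i _ => (hg (σ i) i).hasFDerivAt).differentiableAt
  simp only [Matrix.det_apply']
  have hterm : ∀ σ ∈ (Finset.univ : Finset (Equiv.Perm (Fin 4))), DifferentiableAt ℝ
      (fun y => (Equiv.Perm.sign σ : ℝ) * ∏ i, g y (σ i) i) x := fun σ _ =>
    (hprod σ).const_mul _
  rw [pd_sum l _ hterm, Finset.sum_congr rfl fun i _ => h1 i, Finset.sum_comm]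
  refine Finset.sum_congr rfl fun σ _ => ?_
  rw [pd_const_mul l _ (hprod σ), ← Finset.mul_sum]
  congr 1
  rw [pd, (HasFDerivAt.finsetProd fun i _ => (hg (σ i) i).hasFDerivAt).fderiv]
  simp [pd]

end PartialDerivatives

/-! ### Derivatives of the inverse metric and of the volume factor. -/

section MetricCalculus

variable {g : Spacetime → Matrix (Fin 4) (Fin 4) ℝ} {x : Spacetime}

/-- A twice continuously differentiable metric of Lorentzian volume. -/
structure IsRegularMetric (g : Spacetime → Matrix (Fin 4) (Fin 4) ℝ) : Prop where
  contDiff : ∀ i j, ContDiff ℝ 2 fun y => g y i j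
  symm : ∀ x i j, g x i j = g x j i
  det_pos : ∀ x, 0 < -(g x).det

namespace IsRegularMetric

variable (hg : IsRegularMetric g)
include hg

theorem det_ne_zero (x : Spacetime) : (g x).det ≠ 0 := fun h => by
  have := hg.det_pos x
  rw [h] at this
  simp at this

theorem contDiff_inv (i j : Fin 4) : ContDiff ℝ 2 fun y => (g y)⁻¹ i j :=
  contDiff_iff_contDiffAt.2 fun x => contDiffAt_matrix_inv
    (fun i j => (hg.contDiff i j).contDiffAt) (hg.det_ne_zero x) i j

theorem contDiff_volumeFactor : ContDiff ℝ 2 fun y => volumeFactor (g y) :=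
  contDiff_iff_contDiffAt.2 fun x => contDiffAt_volumeFactor
    (fun i j => (hg.contDiff i j).contDiffAt) (hg.det_ne_zero x)

theorem differentiableAt (x : Spacetime) (i j : Fin 4) :
    DifferentiableAt ℝ (fun y => g y i j) x :=
  (hg.contDiff i j).differentiable (by norm_num) x

theorem differentiableAt_inv (x : Spacetime) (i j : Fin 4) :
    DifferentiableAt ℝ (fun y => (g y)⁻¹ i j) x :=
  (hg.contDiff_inv i j).differentiable (by norm_num) x

theorem differentiableAt_volumeFactor (x : Spacetime) :
    DifferentiableAt ℝ (fun y => volumeFactor (g y)) x :=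
  hg.contDiff_volumeFactor.differentiable (by norm_num) x

theorem transpose_eq (x : Spacetime) : (g x).transpose = g x := by
  ext i j
  exact hg.symm x j i

theorem inv_symm (x : Spacetime) (i j : Fin 4) : (g x)⁻¹ i j = (g x)⁻¹ j i := by
  conv_rhs => rw [← hg.transpose_eq x, ← Matrix.transpose_nonsing_inv]
  rfl

theorem inv_mul (x : Spacetime) : (g x)⁻¹ * g x = 1 :=
  Matrix.nonsing_inv_mul _ (isUnit_iff_ne_zero.2 (hg.det_ne_zero x))

theorem mul_inv (x : Spacetime) : g x * (g x)⁻¹ = 1 :=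
  Matrix.mul_nonsing_inv _ (isUnit_iff_ne_zero.2 (hg.det_ne_zero x))

/-- Differentiate `g⁻¹ g = 1` and multiply by `g⁻¹` on the right. -/
theorem pd_inv (l : Fin 4) (x : Spacetime) (α β : Fin 4) :
    pd l (fun y => (g y)⁻¹ α β) x =
      -∑ σ, ∑ τ, (g x)⁻¹ α σ * pd l (fun y => g y σ τ) x * (g x)⁻¹ τ β := by
  set P : Matrix (Fin 4) (Fin 4) ℝ := Matrix.of fun i j => pd l (fun y => (g y)⁻¹ i j) x with hP
  set D : Matrix (Fin 4) (Fin 4) ℝ := Matrix.of fun i j => pd l (fun y => g y i j) x with hD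
  have h1 : P * g x + (g x)⁻¹ * D = 0 := by
    ext i j
    have h2 : (fun y => ∑ k, (g y)⁻¹ i k * g y k j) = fun _ => (1 : Matrix (Fin 4) (Fin 4) ℝ) i j := by
      funext y
      rw [← Matrix.mul_apply, hg.inv_mul]
    have h3 := congrArg (fun F => pd l F x) h2
    have h5 : ∀ k ∈ (Finset.univ : Finset (Fin 4)),
        DifferentiableAt ℝ (fun y => (g y)⁻¹ i k * g y k j) x := fun k _ =>
      (hg.differentiableAt_inv x i k).mul (hg.differentiableAt x k j)
    rw [pd_const, pd_sum l _ h5] at h3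
    simp only [pd_mul l (hg.differentiableAt_inv x i _) (hg.differentiableAt x _ j)] at h3
    rw [Finset.sum_add_distrib] at h3
    simpa [Matrix.mul_apply, hP, hD] using h3
  have h2 : P = -((g x)⁻¹ * D * (g x)⁻¹) := by
    have h3 : P * g x * (g x)⁻¹ = -((g x)⁻¹ * D) * (g x)⁻¹ := by
      rw [eq_neg_of_add_eq_zero_left h1]
    rw [mul_assoc, hg.mul_inv, mul_one, neg_mul] at h3
    exact h3
  have h4 := congrFun (congrFun h2 α) β
  rw [hP, Matrix.of_apply, Matrix.neg_apply, Matrix.mul_apply] at h4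
  rw [h4, Finset.sum_comm]
  congr 1
  refine Finset.sum_congr rfl fun τ _ => ?_
  rw [Matrix.mul_apply, Finset.sum_mul]
  rfl

theorem pd_volumeFactor (l : Fin 4) (x : Spacetime) :
    pd l (fun y => volumeFactor (g y)) x =
      volumeFactor (g x) * (1 / 2 * ∑ σ, ∑ τ, (g x)⁻¹ σ τ * pd l (fun y => g y σ τ) x) := by
  have hd : DifferentiableAt ℝ (fun y => (g y).det) x :=
    (contDiffAt_det fun i j => (hg.contDiff i j).contDiffAt).differentiableAt (n := 2) (by norm_num)
  have h1 : pd l (fun y => volumeFactor (g y)) x =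
      1 / (2 * Real.sqrt (-(g x).det)) * -pd l (fun y => (g y).det) x := by
    have h2 : fderiv ℝ (fun y => Real.sqrt (-(g y).det)) x =
        (1 / (2 * Real.sqrt (-(g x).det))) • -fderiv ℝ (fun y => (g y).det) x :=
      ((hd.hasFDerivAt.neg).sqrt (neg_ne_zero.2 (hg.det_ne_zero x))).fderiv
    unfold pd volumeFactor
    rw [h2]
    simp
  have hs : Real.sqrt (-(g x).det) ≠ 0 := (Real.sqrt_pos.2 (hg.det_pos x)).ne'
  -- `adj g = det g · g⁻¹`, with `det g` written as `-(√(-det g))²` so that it cancels the root in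
  -- the denominator.
  have hadj : ∀ i j, (g x).adjugate i j = -(Real.sqrt (-(g x).det)) ^ 2 * (g x)⁻¹ i j := by
    intro i j
    rw [Real.sq_sqrt (hg.det_pos x).le, neg_neg, inv_apply_eq,
      mul_inv_cancel_left₀ (hg.det_ne_zero x)]
  rw [h1, pd_det l (hg.differentiableAt x)]
  simp only [hadj, mul_assoc, ← Finset.mul_sum]
  have h3 : ∀ i j, pd l (fun y => g y j i) x = pd l (fun y => g y i j) x := by
    intro i j
    simp only [hg.symm _ j i]
  simp only [h3, volumeFactor]
  field_simp

end IsRegularMetric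

end MetricCalculus

/-! ### The index algebra that separates a divergence from the scalar curvature. -/

section TensorAlgebra

/-- The three adjacent transpositions generate every reordering of a fourfold sum; chains of them
implement the relabelling of dummy indices. -/
theorem sum_swap_right (F : Fin 4 → Fin 4 → Fin 4 → Fin 4 → ℝ) :
    ∑ a, ∑ b, ∑ c, ∑ d, F a b c d = ∑ a, ∑ b, ∑ d, ∑ c, F a b c d :=
  Finset.sum_congr rfl fun _ _ => Finset.sum_congr rfl fun _ _ => Finset.sum_comm

theorem sum_swap_middle (F : Fin 4 → Fin 4 → Fin 4 → Fin 4 → ℝ) :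
    ∑ a, ∑ b, ∑ c, ∑ d, F a b c d = ∑ a, ∑ c, ∑ b, ∑ d, F a b c d :=
  Finset.sum_congr rfl fun _ _ => Finset.sum_comm

theorem sum_swap_left (F : Fin 4 → Fin 4 → Fin 4 → Fin 4 → ℝ) :
    ∑ a, ∑ b, ∑ c, ∑ d, F a b c d = ∑ b, ∑ a, ∑ c, ∑ d, F a b c d :=
  Finset.sum_comm

theorem sum_congr_four {F F' : Fin 4 → Fin 4 → Fin 4 → Fin 4 → ℝ}
    (h : ∀ a b c d, F a b c d = F' a b c d) :
    ∑ a, ∑ b, ∑ c, ∑ d, F a b c d = ∑ a, ∑ b, ∑ c, ∑ d, F' a b c d := by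
  simp only [h]

/-- The algebraic identity behind the decomposition of the scalar curvature density into a
quadratic form of the Christoffel symbols and a divergence. -/
theorem curvature_tensor_identity {gi : Fin 4 → Fin 4 → ℝ} {G : Fin 4 → Fin 4 → Fin 4 → ℝ}
    {dG : Fin 4 → Fin 4 → Fin 4 → Fin 4 → ℝ} (hG : ∀ a μ ν, G a μ ν = G a ν μ)
    (hdG : ∀ l a μ ν, dG l a μ ν = dG l a ν μ) :
    ∑ μ, ∑ ν, gi μ ν * ∑ ρ, (dG ρ ρ μ ν - dG μ ρ ρ ν
        + ∑ σ, (G ρ ρ σ * G σ μ ν - G ρ μ σ * G σ ρ ν)) =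
      ∑ μ, ∑ ν, gi μ ν * (∑ α, ∑ β, G α μ β * G β ν α - ∑ α, ∑ β, G α μ ν * G β α β) +
      ∑ μ, ((∑ τ, G τ μ τ) * (∑ α, ∑ β, gi α β * G μ α β - ∑ α, ∑ β, gi μ α * G β α β) +
        (∑ α, ∑ β, ((-∑ σ, (G α μ σ * gi σ β + G β μ σ * gi α σ)) * G μ α β + gi α β * dG μ μ α β)
        - ∑ α, ∑ β, ((-∑ σ, (G μ μ σ * gi σ α + G α μ σ * gi μ σ)) * G β α β
            + gi μ α * dG μ β α β))) := by
  -- Only these contractions occur. The left side is `X - Y + A - B`. On the right the quadratic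
  -- part is `B - A` and the divergence is `(A - C) + (X - 2 B) - (Y - C - A)`, so `C` cancels.
  set A := ∑ μ, ∑ ν, ∑ ρ, ∑ σ, gi μ ν * (G ρ ρ σ * G σ μ ν) with hA
  set B := ∑ μ, ∑ ν, ∑ ρ, ∑ σ, gi μ ν * (G ρ μ σ * G σ ρ ν) with hB
  set C := ∑ μ, ∑ α, ∑ τ, ∑ β, gi μ α * (G τ μ τ * G β α β) with hC
  set X := ∑ μ, ∑ ν, ∑ ρ, gi μ ν * dG ρ ρ μ ν with hX
  set Y := ∑ μ, ∑ ν, ∑ ρ, gi μ ν * dG μ ρ ρ ν with hY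
  have e1 : ∑ μ, ∑ ν, gi μ ν * ∑ ρ, (dG ρ ρ μ ν - dG μ ρ ρ ν
        + ∑ σ, (G ρ ρ σ * G σ μ ν - G ρ μ σ * G σ ρ ν)) = X - Y + A - B := by
    simp only [hX, hY, hA, hB, Finset.mul_sum, mul_add, mul_sub, Finset.sum_add_distrib,
      Finset.sum_sub_distrib]
    ring
  have e2 : ∑ μ, ∑ ν, gi μ ν * (∑ α, ∑ β, G α μ β * G β ν α - ∑ α, ∑ β, G α μ ν * G β α β) =
      B - A := by
    simp only [Finset.mul_sum, mul_sub, Finset.sum_sub_distrib]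
    refine congrArg₂ _ (sum_congr_four fun μ ν α β => ?_)
      ((sum_swap_right _).trans (sum_congr_four fun μ ν β α => ?_))
    · rw [hG β ν α]
    · rw [hG β β α]
      ring
  have e3 : ∑ μ, (∑ τ, G τ μ τ) * ∑ α, ∑ β, gi α β * G μ α β = A := by
    simp only [Finset.mul_sum, Finset.sum_mul]
    refine (sum_swap_left _).trans ((sum_swap_middle _).trans ((sum_swap_right _).trans
      (sum_congr_four fun α β τ μ => ?_)))
    rw [hG τ τ μ]
    ring
  have e4 : ∑ μ, (∑ τ, G τ μ τ) * ∑ α, ∑ β, gi μ α * G β α β = C := by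
    simp only [Finset.mul_sum, Finset.sum_mul]
    exact (sum_swap_right _).trans (sum_congr_four fun μ α τ β => by ring)
  have e5 : ∑ μ, ∑ α, ∑ β, ∑ σ, G α μ σ * gi σ β * G μ α β = B := by
    refine (sum_swap_left _).trans ((sum_swap_middle _).trans ((sum_swap_right _).trans
      ((sum_swap_middle _).trans ((sum_swap_left _).trans ((sum_swap_middle _).trans
        (sum_congr_four fun σ β α μ => ?_))))))
    rw [hG α μ σ]
    ring
  have e6 : ∑ μ, ∑ α, ∑ β, ∑ σ, G β μ σ * gi α σ * G μ α β = B :=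
    (sum_swap_left _).trans ((sum_swap_right _).trans ((sum_swap_middle _).trans
      (sum_congr_four fun α σ μ β => by ring)))
  have e7 : ∑ μ, ∑ α, ∑ β, ∑ σ, G μ μ σ * gi σ α * G β α β = C := by
    refine (sum_swap_left _).trans ((sum_swap_right _).trans ((sum_swap_middle _).trans
      ((sum_swap_left _).trans (sum_congr_four fun σ α μ β => ?_))))
    rw [hG μ μ σ]
    ring
  have e8 : ∑ μ, ∑ α, ∑ β, ∑ σ, G α μ σ * gi μ σ * G β α β = A := by
    refine (sum_swap_right _).trans ((sum_swap_middle _).trans ((sum_swap_right _).trans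
      (sum_congr_four fun μ σ β α => ?_)))
    rw [hG β β α]
    ring
  have e9 : ∑ μ, ∑ α, ∑ β, gi α β * dG μ μ α β = X := by
    rw [hX, Finset.sum_comm]
    exact Finset.sum_congr rfl fun _ _ => Finset.sum_comm
  have e10 : ∑ μ, ∑ α, ∑ β, gi μ α * dG μ β α β = Y :=
    Finset.sum_congr rfl fun μ _ => Finset.sum_congr rfl fun α _ =>
      Finset.sum_congr rfl fun β _ => by rw [hdG μ β α β]
  rw [e1, e2]
  have e11 : ∀ (a b c d e f g : ℝ), a * (b - c) + (-d + e - (-f + g)) =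
      a * b - a * c - d + e + f - g := by intros; ring
  simp only [neg_mul, Finset.sum_add_distrib, Finset.sum_neg_distrib, e11,
    Finset.sum_sub_distrib, e3, e4, e9, e10]
  simp only [add_mul, Finset.sum_mul, Finset.sum_add_distrib, e5, e6, e7, e8]
  ring

end TensorAlgebra

/-! ### The Lagrangian as a quadratic form in lowered Christoffel symbols plus a divergence. -/

section LoweredChristoffel

variable {g : Spacetime → Matrix (Fin 4) (Fin 4) ℝ} {x : Spacetime}

/-- The Christoffel symbols `Γ_{βμν}` with all indices down. -/
noncomputable def lowChristoffel (g : Spacetime → Matrix (Fin 4) (Fin 4) ℝ) (β μ ν : Fin 4)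
    (x : Spacetime) : ℝ :=
  (1 / 2) * (pd μ (fun y => g y ν β) x + pd ν (fun y => g y μ β) x - pd β (fun y => g y μ ν) x)

theorem christoffel_eq_sum (g : Spacetime → Matrix (Fin 4) (Fin 4) ℝ) (a μ ν : Fin 4)
    (x : Spacetime) :
    christoffel g a μ ν x = ∑ β, (g x)⁻¹ a β * lowChristoffel g β μ ν x := by
  rw [christoffel, Finset.mul_sum]
  exact Finset.sum_congr rfl fun β _ => by rw [lowChristoffel]; ring

/-- The vector field whose divergence is the total derivative part of `√(-g) R`. -/
noncomputable def boundaryVector (g : Spacetime → Matrix (Fin 4) (Fin 4) ℝ) (μ : Fin 4)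
    (x : Spacetime) : ℝ :=
  volumeFactor (g x) * (∑ α, ∑ β, (g x)⁻¹ α β * christoffel g μ α β x
    - ∑ α, ∑ β, (g x)⁻¹ μ α * christoffel g β α β x)

/-- The bilinear combination of Christoffel symbols with lowered indices whose contraction with
`√(-g) g^{μν} g^{αβ} g^{ρσ}` is, up to a divergence and a factor, the Lagrangian. -/
noncomputable def lowBilinear (ε : ℝ) (L : Fin 4 → Fin 4 → Fin 4 → ℝ) (μ ν α β ρ σ : Fin 4) : ℝ :=
  L α μ ρ * L σ ν β - L α μ ν * L ρ β σ - ε / 4 * (L μ α β * L ν ρ σ)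

namespace IsRegularMetric

variable (hg : IsRegularMetric g)
include hg

theorem pd_symm (l : Fin 4) (x : Spacetime) (i j : Fin 4) :
    pd l (fun y => g y i j) x = pd l (fun y => g y j i) x := by
  simp only [hg.symm _ i j]

theorem lowChristoffel_symm (β μ ν : Fin 4) (x : Spacetime) :
    lowChristoffel g β μ ν x = lowChristoffel g β ν μ x := by
  rw [lowChristoffel, lowChristoffel, hg.pd_symm β x μ ν]
  ring

theorem christoffel_symm (a μ ν : Fin 4) (x : Spacetime) :
    christoffel g a μ ν x = christoffel g a ν μ x := by
  simp only [christoffel_eq_sum, hg.lowChristoffel_symm _ μ ν]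

theorem pd_christoffel_symm (l a μ ν : Fin 4) (x : Spacetime) :
    pd l (christoffel g a μ ν) x = pd l (christoffel g a ν μ) x := by
  rw [show christoffel g a μ ν = christoffel g a ν μ from
    funext fun y => hg.christoffel_symm a μ ν y]

theorem pd_metric (l σ τ : Fin 4) (x : Spacetime) :
    pd l (fun y => g y σ τ) x = lowChristoffel g τ l σ x + lowChristoffel g σ l τ x := by
  rw [lowChristoffel, lowChristoffel, hg.pd_symm l x τ σ, hg.pd_symm σ x l τ, hg.pd_symm τ x l σ,
    hg.pd_symm σ x τ l]
  ring

/-- Metric compatibility `∇g⁻¹ = 0`, the form in which `curvature_tensor_identity` takes the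
derivative of the inverse metric. -/
theorem pd_inv_eq (l : Fin 4) (x : Spacetime) (α β : Fin 4) :
    pd l (fun y => (g y)⁻¹ α β) x =
      -∑ σ, (christoffel g α l σ x * (g x)⁻¹ σ β + christoffel g β l σ x * (g x)⁻¹ α σ) := by
  rw [hg.pd_inv, neg_inj]
  simp only [hg.pd_metric, mul_add, add_mul, Finset.sum_add_distrib]
  rw [add_comm]
  congr 1
  · rw [Finset.sum_comm]
    refine Finset.sum_congr rfl fun σ _ => ?_
    rw [christoffel_eq_sum, Finset.sum_mul]
  · refine Finset.sum_congr rfl fun σ _ => ?_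
    rw [christoffel_eq_sum, Finset.sum_mul]
    refine Finset.sum_congr rfl fun τ _ => ?_
    rw [hg.inv_symm x β τ]
    ring

/-- The two halves of `∂_l g` from `pd_metric` contribute the same trace, which absorbs the `1/2`.
-/
theorem pd_volumeFactor_eq (l : Fin 4) (x : Spacetime) :
    pd l (fun y => volumeFactor (g y)) x =
      volumeFactor (g x) * ∑ τ, christoffel g τ l τ x := by
  rw [hg.pd_volumeFactor]
  simp only [hg.pd_metric, mul_add, Finset.sum_add_distrib]
  have h1 : ∑ σ, ∑ τ, (g x)⁻¹ σ τ * lowChristoffel g τ l σ x = ∑ τ, christoffel g τ l τ x :=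
    Finset.sum_congr rfl fun σ _ => (christoffel_eq_sum g σ l σ x).symm
  have h2 : ∑ σ, ∑ τ, (g x)⁻¹ σ τ * lowChristoffel g σ l τ x = ∑ τ, christoffel g τ l τ x := by
    rw [Finset.sum_comm]
    refine Finset.sum_congr rfl fun τ _ => ?_
    rw [christoffel_eq_sum]
    exact Finset.sum_congr rfl fun σ _ => by rw [hg.inv_symm x σ τ]
  rw [h1, h2]
  ring

theorem contDiff_lowChristoffel (β μ ν : Fin 4) : ContDiff ℝ 1 (lowChristoffel g β μ ν) := by
  have h : ∀ l i j, ContDiff ℝ 1 (pd l fun y => g y i j) := fun l i j =>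
    contDiff_pd (n := 1) l (by simpa [one_add_one_eq_two] using hg.contDiff i j)
  exact contDiff_const.mul (((h μ ν β).add (h ν μ β)).sub (h β μ ν))

theorem contDiff_christoffel (a μ ν : Fin 4) : ContDiff ℝ 1 (christoffel g a μ ν) := by
  rw [show christoffel g a μ ν = fun x => ∑ β, (g x)⁻¹ a β * lowChristoffel g β μ ν x from
    funext fun x => christoffel_eq_sum g a μ ν x]
  exact ContDiff.sum fun β _ => ((hg.contDiff_inv a β).of_le (by norm_num)).mul
    (hg.contDiff_lowChristoffel β μ ν)

theorem differentiableAt_christoffel (a μ ν : Fin 4) (x : Spacetime) :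
    DifferentiableAt ℝ (christoffel g a μ ν) x :=
  (hg.contDiff_christoffel a μ ν).differentiable (by norm_num) x

theorem differentiableAt_inv_mul_christoffel (i j a μ ν : Fin 4) (x : Spacetime) :
    DifferentiableAt ℝ (fun y => (g y)⁻¹ i j * christoffel g a μ ν y) x :=
  (hg.differentiableAt_inv x i j).mul (hg.differentiableAt_christoffel a μ ν x)

theorem differentiableAt_boundarySum₁ (μ : Fin 4) (x : Spacetime) :
    DifferentiableAt ℝ (fun y => ∑ α, ∑ β, (g y)⁻¹ α β * christoffel g μ α β y) x :=
  DifferentiableAt.fun_sum fun α _ => DifferentiableAt.fun_sum fun β _ =>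
    hg.differentiableAt_inv_mul_christoffel α β μ α β x

theorem differentiableAt_boundarySum₂ (μ : Fin 4) (x : Spacetime) :
    DifferentiableAt ℝ (fun y => ∑ α, ∑ β, (g y)⁻¹ μ α * christoffel g β α β y) x :=
  DifferentiableAt.fun_sum fun α _ => DifferentiableAt.fun_sum fun β _ =>
    hg.differentiableAt_inv_mul_christoffel μ α β α β x

theorem differentiableAt_boundaryVector (μ : Fin 4) (x : Spacetime) :
    DifferentiableAt ℝ (boundaryVector g μ) x :=
  (hg.differentiableAt_volumeFactor x).mul
    ((hg.differentiableAt_boundarySum₁ μ x).sub (hg.differentiableAt_boundarySum₂ μ x))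

theorem pd_boundaryVector (μ : Fin 4) (x : Spacetime) :
    pd μ (boundaryVector g μ) x = volumeFactor (g x) *
      ((∑ τ, christoffel g τ μ τ x) * (∑ α, ∑ β, (g x)⁻¹ α β * christoffel g μ α β x
          - ∑ α, ∑ β, (g x)⁻¹ μ α * christoffel g β α β x) +
        (∑ α, ∑ β, (pd μ (fun y => (g y)⁻¹ α β) x * christoffel g μ α β x
            + (g x)⁻¹ α β * pd μ (christoffel g μ α β) x)
          - ∑ α, ∑ β, (pd μ (fun y => (g y)⁻¹ μ α) x * christoffel g β α β x
            + (g x)⁻¹ μ α * pd μ (christoffel g β α β) x))) := by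
  have h0 := pd_mul μ (hg.differentiableAt_volumeFactor x)
    ((hg.differentiableAt_boundarySum₁ μ x).sub (hg.differentiableAt_boundarySum₂ μ x))
  have h1 := pd_sub μ (hg.differentiableAt_boundarySum₁ μ x) (hg.differentiableAt_boundarySum₂ μ x)
  have h2 : pd μ (fun y => ∑ α, ∑ β, (g y)⁻¹ α β * christoffel g μ α β y) x =
      ∑ α, ∑ β, (pd μ (fun y => (g y)⁻¹ α β) x * christoffel g μ α β x
            + (g x)⁻¹ α β * pd μ (christoffel g μ α β) x) := by
    rw [pd_sum μ _ fun α _ => DifferentiableAt.fun_sum fun β _ =>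
      hg.differentiableAt_inv_mul_christoffel α β μ α β x]
    refine Finset.sum_congr rfl fun α _ => ?_
    rw [pd_sum μ _ fun β _ => hg.differentiableAt_inv_mul_christoffel α β μ α β x]
    exact Finset.sum_congr rfl fun β _ => pd_mul μ (hg.differentiableAt_inv x α β)
      (hg.differentiableAt_christoffel μ α β x)
  have h3 : pd μ (fun y => ∑ α, ∑ β, (g y)⁻¹ μ α * christoffel g β α β y) x =
      ∑ α, ∑ β, (pd μ (fun y => (g y)⁻¹ μ α) x * christoffel g β α β x
            + (g x)⁻¹ μ α * pd μ (christoffel g β α β) x) := by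
    rw [pd_sum μ _ fun α _ => DifferentiableAt.fun_sum fun β _ =>
      hg.differentiableAt_inv_mul_christoffel μ α β α β x]
    refine Finset.sum_congr rfl fun α _ => ?_
    rw [pd_sum μ _ fun β _ => hg.differentiableAt_inv_mul_christoffel μ α β α β x]
    exact Finset.sum_congr rfl fun β _ => pd_mul μ (hg.differentiableAt_inv x μ α)
      (hg.differentiableAt_christoffel β α β x)
  rw [← h2, ← h3, mul_add, ← mul_assoc, ← hg.pd_volumeFactor_eq, ← h1]
  exact h0

/-- The scalar curvature density is a quadratic form of the Christoffel symbols up to a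
divergence. -/
theorem volumeFactor_mul_scalarCurvature (x : Spacetime) :
    volumeFactor (g x) * scalarCurvature g x =
      volumeFactor (g x) * ∑ μ, ∑ ν, (g x)⁻¹ μ ν *
        (∑ α, ∑ β, christoffel g α μ β x * christoffel g β ν α x
          - ∑ α, ∑ β, christoffel g α μ ν x * christoffel g β α β x)
      + ∑ μ, pd μ (boundaryVector g μ) x := by
  have key := curvature_tensor_identity (gi := fun i j => (g x)⁻¹ i j)
    (G := fun a μ ν => christoffel g a μ ν x)
    (dG := fun l a μ ν => pd l (christoffel g a μ ν) x)
    (fun a μ ν => hg.christoffel_symm a μ ν x) (fun l a μ ν => hg.pd_christoffel_symm l a μ ν x)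
  simp only [hg.pd_boundaryVector, hg.pd_inv_eq]
  rw [← Finset.mul_sum _ _ (volumeFactor (g x)), ← mul_add]
  exact congrArg _ key

/-- This and the next two identities lower all Christoffel indices, bringing the three quadratic
terms over the common prefactor `g^{μν} g^{αβ} g^{ρσ}` of the kernel. -/
theorem quadratic_first (x : Spacetime) :
    ∑ μ, ∑ ν, (g x)⁻¹ μ ν * ∑ α, ∑ β, christoffel g α μ β x * christoffel g β ν α x =
      ∑ μ, ∑ ν, ∑ α, ∑ β, ∑ ρ, ∑ σ, (g x)⁻¹ μ ν * (g x)⁻¹ α β * (g x)⁻¹ ρ σ *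
        (lowChristoffel g α μ ρ x * lowChristoffel g σ ν β x) := by
  refine Finset.sum_congr rfl fun μ _ => Finset.sum_congr rfl fun ν _ => ?_
  simp only [christoffel_eq_sum, Finset.mul_sum, Finset.sum_mul]
  refine (sum_swap_right _).trans ((sum_swap_middle _).trans ((sum_swap_left _).trans
    (sum_congr_four fun α β ρ σ => ?_)))
  rw [hg.inv_symm x β α]
  ring

theorem quadratic_second (x : Spacetime) :
    ∑ μ, ∑ ν, (g x)⁻¹ μ ν * ∑ α, ∑ β, christoffel g α μ ν x * christoffel g β α β x =
      ∑ μ, ∑ ν, ∑ α, ∑ β, ∑ ρ, ∑ σ, (g x)⁻¹ μ ν * (g x)⁻¹ α β * (g x)⁻¹ ρ σ *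
        (lowChristoffel g α μ ν x * lowChristoffel g ρ β σ x) := by
  refine Finset.sum_congr rfl fun μ _ => Finset.sum_congr rfl fun ν _ => ?_
  simp only [christoffel_eq_sum, Finset.mul_sum, Finset.sum_mul]
  refine (sum_swap_right _).trans ((sum_swap_middle _).trans ((sum_swap_left _).trans
    ((sum_swap_right _).trans (sum_congr_four fun α β ρ σ => ?_))))
  rw [hg.inv_symm x β α, hg.inv_symm x σ ρ]
  ring

/-- Here `𝒢 = g⁻¹ V` with `V_b = g^{αβ} Γ_{bαβ}`, so `g(𝒢, 𝒢) = g⁻¹(V, V)` and the explicit `g`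
disappears. -/
theorem quadratic_third (x : Spacetime) :
    ∑ μ, ∑ ν, g x μ ν * gaugeVector g μ x * gaugeVector g ν x =
      ∑ μ, ∑ ν, ∑ α, ∑ β, ∑ ρ, ∑ σ, (g x)⁻¹ μ ν * (g x)⁻¹ α β * (g x)⁻¹ ρ σ *
        (lowChristoffel g μ α β x * lowChristoffel g ν ρ σ x) := by
  set V : Fin 4 → ℝ := fun b => ∑ α, ∑ β, (g x)⁻¹ α β * lowChristoffel g b α β x with hV
  have h1 : (fun μ => gaugeVector g μ x) = (g x)⁻¹.mulVec V := by
    funext μ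
    simp only [gaugeVector, christoffel_eq_sum, Matrix.mulVec, dotProduct, hV, Finset.mul_sum]
    rw [Finset.sum_congr rfl fun α _ => Finset.sum_comm, Finset.sum_comm]
    refine Finset.sum_congr rfl fun _ _ => Finset.sum_congr rfl fun _ _ =>
      Finset.sum_congr rfl fun _ _ => by ring
  have h2 : ∑ μ, ∑ ν, g x μ ν * gaugeVector g μ x * gaugeVector g ν x =
      dotProduct ((g x)⁻¹.mulVec V) ((g x).mulVec ((g x)⁻¹.mulVec V)) := by
    rw [← h1]
    simp only [dotProduct, Matrix.mulVec, Finset.mul_sum]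
    exact Finset.sum_congr rfl fun _ _ => Finset.sum_congr rfl fun _ _ => by ring
  rw [h2, Matrix.mulVec_mulVec, hg.mul_inv, Matrix.one_mulVec, dotProduct]
  simp only [Matrix.mulVec, dotProduct, Finset.sum_mul]
  refine Finset.sum_congr rfl fun μ _ => Finset.sum_congr rfl fun ν _ => ?_
  simp only [hV, Finset.mul_sum, Finset.sum_mul]
  exact sum_congr_four fun α β ρ σ => by ring

/-- The gauge fixed Lagrangian density is, up to a divergence, a quadratic form of the Christoffel
symbols with lowered indices. -/
theorem lagrangian_decomposition (κ ε : ℝ) (x : Spacetime) :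
    volumeFactor (g x) * (-(2 / κ ^ 2) * scalarCurvature g x
      + ε / (2 * κ ^ 2) * ∑ μ, ∑ ν, g x μ ν * gaugeVector g μ x * gaugeVector g ν x) =
    -(2 / κ ^ 2) * ∑ μ, ∑ ν, ∑ α, ∑ β, ∑ ρ, ∑ σ,
      volumeFactor (g x) * (g x)⁻¹ μ ν * (g x)⁻¹ α β * (g x)⁻¹ ρ σ *
        lowBilinear ε (fun a b c => lowChristoffel g a b c x) μ ν α β ρ σ
      - 2 / κ ^ 2 * ∑ μ, pd μ (boundaryVector g μ) x := by
  have h1 : ∑ μ, ∑ ν, ∑ α, ∑ β, ∑ ρ, ∑ σ,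
      volumeFactor (g x) * (g x)⁻¹ μ ν * (g x)⁻¹ α β * (g x)⁻¹ ρ σ *
        lowBilinear ε (fun a b c => lowChristoffel g a b c x) μ ν α β ρ σ =
      volumeFactor (g x) * (∑ μ, ∑ ν, (g x)⁻¹ μ ν *
        (∑ α, ∑ β, christoffel g α μ β x * christoffel g β ν α x
          - ∑ α, ∑ β, christoffel g α μ ν x * christoffel g β α β x)
        - ε / 4 * ∑ μ, ∑ ν, g x μ ν * gaugeVector g μ x * gaugeVector g ν x) := by
    have h0 : ∑ μ, ∑ ν, (g x)⁻¹ μ ν *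
        (∑ α, ∑ β, christoffel g α μ β x * christoffel g β ν α x
          - ∑ α, ∑ β, christoffel g α μ ν x * christoffel g β α β x) =
        ∑ μ, ∑ ν, (g x)⁻¹ μ ν * ∑ α, ∑ β, christoffel g α μ β x * christoffel g β ν α x
        - ∑ μ, ∑ ν, (g x)⁻¹ μ ν * ∑ α, ∑ β, christoffel g α μ ν x * christoffel g β α β x := by
      simp only [mul_sub, Finset.sum_sub_distrib]
    rw [h0, hg.quadratic_first, hg.quadratic_second, hg.quadratic_third]
    simp only [Finset.mul_sum, ← Finset.sum_sub_distrib]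
    refine Finset.sum_congr rfl fun μ _ => Finset.sum_congr rfl fun ν _ =>
      sum_congr_four fun α β ρ σ => ?_
    rw [lowBilinear]
    ring
  have h2 := hg.volumeFactor_mul_scalarCurvature x
  have h3 : volumeFactor (g x) * (-(2 / κ ^ 2) * scalarCurvature g x
      + ε / (2 * κ ^ 2) * ∑ μ, ∑ ν, g x μ ν * gaugeVector g μ x * gaugeVector g ν x) =
      -(2 / κ ^ 2) * (volumeFactor (g x) * scalarCurvature g x) + ε / (2 * κ ^ 2) *
        (volumeFactor (g x) * ∑ μ, ∑ ν, g x μ ν * gaugeVector g μ x * gaugeVector g ν x) := by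
    ring
  rw [h1, h3, h2]
  ring

end IsRegularMetric

end LoweredChristoffel

/-! ### Bounded and integrable functions, and the vanishing of integrals of derivatives. -/

section Decay

/-- Bounded continuous functions on spacetime. -/
def IsTame (f : Spacetime → ℝ) : Prop := Continuous f ∧ ∃ C, ∀ x, |f x| ≤ C

/-- Bounded continuous integrable functions on spacetime. -/
def IsDecaying (f : Spacetime → ℝ) : Prop := IsTame f ∧ Integrable f

variable {f k : Spacetime → ℝ} {ι : Type*}

theorem IsTame.add (hf : IsTame f) (hk : IsTame k) : IsTame fun x => f x + k x := by
  obtain ⟨hf, C, hC⟩ := hf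
  obtain ⟨hk, D, hD⟩ := hk
  exact ⟨hf.add hk, C + D, fun x => (abs_add_le _ _).trans (add_le_add (hC x) (hD x))⟩

theorem IsTame.mul (hf : IsTame f) (hk : IsTame k) : IsTame fun x => f x * k x := by
  obtain ⟨hf, C, hC⟩ := hf
  obtain ⟨hk, D, hD⟩ := hk
  refine ⟨hf.mul hk, C * D, fun x => ?_⟩
  rw [abs_mul]
  exact mul_le_mul (hC x) (hD x) (abs_nonneg _) ((abs_nonneg _).trans (hC x))

theorem isTame_const (c : ℝ) : IsTame fun _ => c := ⟨continuous_const, |c|, fun _ => le_rfl⟩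

theorem IsDecaying.isTame (hf : IsDecaying f) : IsTame f := hf.1

theorem IsDecaying.add (hf : IsDecaying f) (hk : IsDecaying k) :
    IsDecaying fun x => f x + k x := ⟨hf.1.add hk.1, hf.2.add hk.2⟩

/-- Decaying functions form an ideal among tame ones: a product of tame factors is integrable as
soon as one factor decays, here always one containing a derivative of the metric. -/
theorem IsTame.mul_isDecaying (hf : IsTame f) (hk : IsDecaying k) :
    IsDecaying fun x => f x * k x := by
  refine ⟨hf.mul hk.1, ?_⟩
  obtain ⟨hf, C, hC⟩ := hf
  exact hk.2.bdd_mul hf.aestronglyMeasurable (Filter.Eventually.of_forall hC)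

theorem IsDecaying.mul_isTame (hf : IsDecaying f) (hk : IsTame k) :
    IsDecaying fun x => f x * k x := by
  simpa only [mul_comm] using hk.mul_isDecaying hf

theorem IsDecaying.mul (hf : IsDecaying f) (hk : IsDecaying k) :
    IsDecaying fun x => f x * k x := hf.mul_isTame hk.1

theorem IsDecaying.const_mul (c : ℝ) (hf : IsDecaying f) : IsDecaying fun x => c * f x :=
  (isTame_const c).mul_isDecaying hf

theorem IsDecaying.neg (hf : IsDecaying f) : IsDecaying fun x => -f x := by
  simpa only [neg_one_mul] using hf.const_mul (-1)

theorem IsDecaying.sub (hf : IsDecaying f) (hk : IsDecaying k) :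
    IsDecaying fun x => f x - k x := by
  simpa only [sub_eq_add_neg] using hf.add hk.neg

theorem isDecaying_zero : IsDecaying fun _ => 0 :=
  ⟨isTame_const 0, integrable_zero _ _ _⟩

theorem IsDecaying.sum {s : Finset ι} {F : ι → Spacetime → ℝ} (hF : ∀ i ∈ s, IsDecaying (F i)) :
    IsDecaying fun x => ∑ i ∈ s, F i x := by
  classical
  induction s using Finset.induction_on with
  | empty => simpa using isDecaying_zero
  | insert a s ha ih =>
    simp only [Finset.sum_insert ha]
    exact (hF a (Finset.mem_insert_self a s)).add
      (ih fun i hi => hF i (Finset.mem_insert_of_mem hi))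

theorem isDecaying_schwartz (f : 𝓢(Spacetime, ℝ)) : IsDecaying f := by
  refine ⟨⟨f.continuous, ‖f.toBoundedContinuousFunction‖, fun x => ?_⟩, f.integrable⟩
  exact f.toBoundedContinuousFunction.norm_coe_le_norm x

theorem IsDecaying.integral_pd_eq_zero (l : Fin 4) (hf : IsDecaying f)
    (hd : ∀ x, DifferentiableAt ℝ f x) (hpd : IsDecaying (pd l f)) : ∫ x, pd l f x = 0 := by
  -- Integration by parts against the constant function `1`, whose derivative is zero.
  have := integral_mul_fderiv_eq_neg_fderiv_mul_of_integrable (μ := (volume : Measure Spacetime))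
    (f := fun _ => (1 : ℝ)) (g := f) (v := EuclideanSpace.single l 1) (by simp)
    (by simp only [one_mul]; exact hpd.2) (by simpa using hf.2) (fun x _ => differentiableAt_const _)
    (fun x _ => hd x)
  simpa [pd] using this

end Decay

/-! ### Integrability of the Lagrangian and removal of the divergence. -/

section AsymptoticallyFlat

variable {g : Spacetime → Matrix (Fin 4) (Fin 4) ℝ}

/-- A regular metric which is uniformly nondegenerate and has decaying derivatives. -/
structure IsFlatMetric (g : Spacetime → Matrix (Fin 4) (Fin 4) ℝ) : Prop
    extends IsRegularMetric g where
  isTame : ∀ i j, IsTame fun y => g y i j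
  isTame_inv : ∀ i j, IsTame fun y => (g y)⁻¹ i j
  isTame_volumeFactor : IsTame fun y => volumeFactor (g y)
  isDecaying_pd : ∀ l i j, IsDecaying (pd l fun y => g y i j)
  isDecaying_pd_pd : ∀ k l i j, IsDecaying (pd k (pd l fun y => g y i j))

namespace IsFlatMetric

variable (hg : IsFlatMetric g)
include hg

theorem isDecaying_lowChristoffel (β μ ν : Fin 4) : IsDecaying (lowChristoffel g β μ ν) :=
  (((hg.isDecaying_pd μ ν β).add (hg.isDecaying_pd ν μ β)).sub
    (hg.isDecaying_pd β μ ν)).const_mul (1 / 2)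

theorem isDecaying_pd_lowChristoffel (l β μ ν : Fin 4) :
    IsDecaying (pd l (lowChristoffel g β μ ν)) := by
  have hd : ∀ k i j x, DifferentiableAt ℝ (pd k fun y => g y i j) x := fun k i j x =>
    (contDiff_pd (n := 1) k (by simpa [one_add_one_eq_two] using hg.contDiff i j)).differentiable
      (by norm_num) x
  have h : pd l (lowChristoffel g β μ ν) = fun x => 1 / 2 * (pd l (pd μ fun y => g y ν β) x
      + pd l (pd ν fun y => g y μ β) x - pd l (pd β fun y => g y μ ν) x) := by
    funext x
    have hadd : DifferentiableAt ℝ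
        (fun z => pd μ (fun y => g y ν β) z + pd ν (fun y => g y μ β) z) x :=
      (hd μ ν β x).add (hd ν μ β x)
    rw [← pd_add l (hd μ ν β x) (hd ν μ β x), ← pd_sub l hadd (hd β μ ν x)]
    exact pd_const_mul l _ (hadd.sub (hd β μ ν x))
  rw [h]
  exact (((hg.isDecaying_pd_pd l μ ν β).add (hg.isDecaying_pd_pd l ν μ β)).sub
    (hg.isDecaying_pd_pd l β μ ν)).const_mul (1 / 2)

theorem isDecaying_christoffel (a μ ν : Fin 4) : IsDecaying (christoffel g a μ ν) := by
  rw [show christoffel g a μ ν = fun x => ∑ β, (g x)⁻¹ a β * lowChristoffel g β μ ν x from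
    funext fun x => christoffel_eq_sum g a μ ν x]
  exact IsDecaying.sum fun β _ => (hg.isTame_inv a β).mul_isDecaying
    (hg.isDecaying_lowChristoffel β μ ν)

theorem isDecaying_pd_inv (l i j : Fin 4) : IsDecaying (pd l fun y => (g y)⁻¹ i j) := by
  rw [show (pd l fun y => (g y)⁻¹ i j) = fun x => -∑ σ, (christoffel g i l σ x * (g x)⁻¹ σ j +
    christoffel g j l σ x * (g x)⁻¹ i σ) from funext fun x => hg.pd_inv_eq l x i j]
  exact (IsDecaying.sum fun σ _ => ((hg.isDecaying_christoffel i l σ).mul_isTame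
    (hg.isTame_inv σ j)).add ((hg.isDecaying_christoffel j l σ).mul_isTame
      (hg.isTame_inv i σ))).neg

theorem isDecaying_pd_christoffel (l a μ ν : Fin 4) :
    IsDecaying (pd l (christoffel g a μ ν)) := by
  have hd : ∀ β x, DifferentiableAt ℝ (lowChristoffel g β μ ν) x := fun β x =>
    (hg.contDiff_lowChristoffel β μ ν).differentiable (by norm_num) x
  have h : pd l (christoffel g a μ ν) = fun x => ∑ β, (pd l (fun y => (g y)⁻¹ a β) x *
      lowChristoffel g β μ ν x + (g x)⁻¹ a β * pd l (lowChristoffel g β μ ν) x) := by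
    funext x
    have hterm : ∀ β ∈ (Finset.univ : Finset (Fin 4)),
        DifferentiableAt ℝ (fun y => (g y)⁻¹ a β * lowChristoffel g β μ ν y) x := fun β _ =>
      (hg.differentiableAt_inv x a β).mul (hd β x)
    rw [show christoffel g a μ ν = fun x => ∑ β, (g x)⁻¹ a β * lowChristoffel g β μ ν x from
      funext fun x => christoffel_eq_sum g a μ ν x, pd_sum l _ hterm]
    exact Finset.sum_congr rfl fun β _ => pd_mul l (hg.differentiableAt_inv x a β) (hd β x)
  rw [h]
  exact IsDecaying.sum fun β _ => ((hg.isDecaying_pd_inv l a β).mul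
    (hg.isDecaying_lowChristoffel β μ ν)).add ((hg.isTame_inv a β).mul_isDecaying
      (hg.isDecaying_pd_lowChristoffel l β μ ν))

theorem isDecaying_scalarCurvature : IsDecaying (scalarCurvature g) :=
  IsDecaying.sum fun μ _ => IsDecaying.sum fun ν _ => (hg.isTame_inv μ ν).mul_isDecaying <|
    IsDecaying.sum fun ρ _ => ((hg.isDecaying_pd_christoffel ρ ρ μ ν).sub
      (hg.isDecaying_pd_christoffel μ ρ ρ ν)).add <| IsDecaying.sum fun σ _ =>
        ((hg.isDecaying_christoffel ρ ρ σ).mul (hg.isDecaying_christoffel σ μ ν)).sub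
          ((hg.isDecaying_christoffel ρ μ σ).mul (hg.isDecaying_christoffel σ ρ ν))

theorem isDecaying_gaugeVector (μ : Fin 4) : IsDecaying (gaugeVector g μ) :=
  IsDecaying.sum fun α _ => IsDecaying.sum fun β _ => (hg.isTame_inv α β).mul_isDecaying
    (hg.isDecaying_christoffel μ α β)

theorem isDecaying_lagrangian (κ ε : ℝ) : IsDecaying fun x =>
    volumeFactor (g x) * (-(2 / κ ^ 2) * scalarCurvature g x
      + ε / (2 * κ ^ 2) * ∑ μ, ∑ ν, g x μ ν * gaugeVector g μ x * gaugeVector g ν x) :=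
  hg.isTame_volumeFactor.mul_isDecaying <| (hg.isDecaying_scalarCurvature.const_mul _).add <|
    IsDecaying.const_mul _ <| IsDecaying.sum fun μ _ => IsDecaying.sum fun ν _ =>
      ((hg.isTame μ ν).mul_isDecaying (hg.isDecaying_gaugeVector μ)).mul
        (hg.isDecaying_gaugeVector ν)

theorem isDecaying_boundaryFactor (μ : Fin 4) : IsDecaying fun x =>
    ∑ α, ∑ β, (g x)⁻¹ α β * christoffel g μ α β x
      - ∑ α, ∑ β, (g x)⁻¹ μ α * christoffel g β α β x :=
  (IsDecaying.sum fun α _ => IsDecaying.sum fun β _ => (hg.isTame_inv α β).mul_isDecaying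
    (hg.isDecaying_christoffel μ α β)).sub (IsDecaying.sum fun α _ => IsDecaying.sum fun β _ =>
      (hg.isTame_inv μ α).mul_isDecaying (hg.isDecaying_christoffel β α β))

theorem isDecaying_boundaryVector (μ : Fin 4) : IsDecaying (boundaryVector g μ) :=
  hg.isTame_volumeFactor.mul_isDecaying (hg.isDecaying_boundaryFactor μ)

theorem isDecaying_pd_boundaryVector (μ : Fin 4) : IsDecaying (pd μ (boundaryVector g μ)) := by
  rw [show pd μ (boundaryVector g μ) = _ from funext fun x => hg.pd_boundaryVector μ x]
  have h1 := fun i j a b c l => (((hg.isDecaying_pd_inv l i j).mul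
    (hg.isDecaying_christoffel a b c)).add ((hg.isTame_inv i j).mul_isDecaying
      (hg.isDecaying_pd_christoffel l a b c)))
  exact hg.isTame_volumeFactor.mul_isDecaying <| ((IsDecaying.sum fun τ _ =>
    hg.isDecaying_christoffel τ μ τ).mul (hg.isDecaying_boundaryFactor μ)).add <|
      (IsDecaying.sum fun α _ => IsDecaying.sum fun β _ => h1 α β μ α β μ).sub
        (IsDecaying.sum fun α _ => IsDecaying.sum fun β _ => h1 μ α β α β μ)

theorem integral_pd_boundaryVector (μ : Fin 4) :
    ∫ x, pd μ (boundaryVector g μ) x = 0 :=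
  (hg.isDecaying_boundaryVector μ).integral_pd_eq_zero μ (hg.differentiableAt_boundaryVector μ)
    (hg.isDecaying_pd_boundaryVector μ)

theorem integral_lagrangian (κ ε : ℝ) :
    ∫ x, volumeFactor (g x) * (-(2 / κ ^ 2) * scalarCurvature g x
      + ε / (2 * κ ^ 2) * ∑ μ, ∑ ν, g x μ ν * gaugeVector g μ x * gaugeVector g ν x) =
    ∫ x, -(2 / κ ^ 2) * ∑ μ, ∑ ν, ∑ α, ∑ β, ∑ ρ, ∑ σ,
      volumeFactor (g x) * (g x)⁻¹ μ ν * (g x)⁻¹ α β * (g x)⁻¹ ρ σ *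
        lowBilinear ε (fun a b c => lowChristoffel g a b c x) μ ν α β ρ σ := by
  have h1 := (hg.isDecaying_lagrangian κ ε).2
  have h2 : Integrable fun x => 2 / κ ^ 2 * ∑ μ, pd μ (boundaryVector g μ) x :=
    ((IsDecaying.sum fun μ _ => hg.isDecaying_pd_boundaryVector μ).const_mul _).2
  have h3 : ∫ x, 2 / κ ^ 2 * ∑ μ, pd μ (boundaryVector g μ) x = 0 := by
    rw [integral_const_mul, integral_finsetSum _ fun μ _ => (hg.isDecaying_pd_boundaryVector μ).2]
    simp only [hg.integral_pd_boundaryVector, Finset.sum_const_zero, mul_zero]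
  rw [← add_zero (∫ x, volumeFactor (g x) * _), ← h3, ← integral_add h1 h2]
  congr 1
  funext x
  rw [hg.lagrangian_decomposition]
  ring

end IsFlatMetric

end AsymptoticallyFlat

/-! ### The metric `η + κ h` and the first-order form of its action. -/

section MetricOfPerturbation

variable {κ : ℝ} {h : Perturbation}

/-- The tensor `κ h(x)`. -/
noncomputable def fieldValue (κ : ℝ) (h : Perturbation) (x : Spacetime) : TensorValue :=
  fun μ ν => κ * h μ ν x

theorem metric_eq (κ : ℝ) (h : Perturbation) (x : Spacetime) :
    metric κ h x = eta + Matrix.of (fieldValue κ h x) := rfl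

theorem metric_apply (κ : ℝ) (h : Perturbation) (x : Spacetime) (i j : Fin 4) :
    metric κ h x i j = eta i j + κ * h i j x := rfl

theorem continuous_fieldValue (κ : ℝ) (h : Perturbation) : Continuous (fieldValue κ h) :=
  continuous_pi fun μ => continuous_pi fun ν => continuous_const.mul (h μ ν).continuous

/-- Schwartz functions tend to `0` at infinity, so adjoining the limit `0` makes the range compact.
All bounds uniform in `x` rest on this. -/
theorem isCompact_fieldValues (κ : ℝ) (h : Perturbation) :
    IsCompact (insert 0 (Set.range (fieldValue κ h))) := by
  refine Filter.Tendsto.isCompact_insert_range_of_cocompact ?_ (continuous_fieldValue κ h)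
  refine tendsto_pi_nhds.2 fun μ => tendsto_pi_nhds.2 fun ν => ?_
  simpa [fieldValue] using ((h μ ν).tendsto_cocompact).const_mul κ

theorem nondegenerate_fieldValues (hnd : ∀ x, Nondegenerate (fieldValue κ h x)) :
    ∀ H ∈ insert 0 (Set.range (fieldValue κ h)), Nondegenerate H := by
  rintro H (rfl | ⟨x, rfl⟩)
  · exact nondegenerate_zero
  · exact hnd x

theorem isTame_comp_fieldValue (hnd : ∀ x, Nondegenerate (fieldValue κ h x)) {X : TensorValue → ℝ}
    (hX : ∀ H, Nondegenerate H → ContinuousAt X H) : IsTame fun x => X (fieldValue κ h x) := by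
  refine ⟨continuous_iff_continuousAt.2 fun x =>
    (hX _ (hnd x)).comp (continuous_fieldValue κ h).continuousAt, ?_⟩
  obtain ⟨C, hC⟩ := (isCompact_fieldValues κ h).exists_bound_of_continuousOn (f := X)
    fun H hH => (hX H (nondegenerate_fieldValues hnd H hH)).continuousWithinAt
  exact ⟨C, fun x => hC _ (Set.mem_insert_of_mem _ ⟨x, rfl⟩)⟩

theorem pd_metric_apply (l i j : Fin 4) (x : Spacetime) :
    pd l (fun y => metric κ h y i j) x = κ * schwartzPd l (h i j) x := by
  simp only [metric_apply]
  rw [pd_add l (differentiableAt_const _) ((h i j).differentiableAt.const_mul κ), pd_const,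
    pd_const_mul l κ (h i j).differentiableAt, zero_add, schwartzPd_apply]

theorem isFlatMetric_metric (hs : h.IsSymm) (hnd : ∀ x, Nondegenerate (fieldValue κ h x)) :
    IsFlatMetric (metric κ h) where
  contDiff i j := contDiff_const.add (contDiff_const.mul ((h i j).smooth 2))
  symm x i j := by
    rw [metric_apply, metric_apply, hs i j, eta]
    congr 1
    by_cases hij : i = j
    · rw [hij]
    · rw [Matrix.diagonal_apply_ne _ hij, Matrix.diagonal_apply_ne' _ hij]
  det_pos x := (hnd x).neg_det_pos
  isTame i j := (isTame_const _).add ((isDecaying_schwartz (h i j)).const_mul κ).isTame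
  isTame_inv i j := isTame_comp_fieldValue hnd (X := fun H => (eta + Matrix.of H)⁻¹ i j)
    fun H hH => (contDiffAt_matrix_inv (n := 0) (M := fun H : TensorValue => eta + Matrix.of H)
      contDiffAt_metric_entry hH.det_ne_zero i j).continuousAt
  isTame_volumeFactor := isTame_comp_fieldValue hnd (X := fun H => volumeFactor (eta + Matrix.of H))
    fun H hH => (contDiffAt_volumeFactor (n := 0) (M := fun H : TensorValue => eta + Matrix.of H)
      contDiffAt_metric_entry hH.det_ne_zero).continuousAt
  isDecaying_pd l i j := by
    rw [show (pd l fun y => metric κ h y i j) = fun x => κ * schwartzPd l (h i j) x from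
      funext fun x => pd_metric_apply l i j x]
    exact (isDecaying_schwartz _).const_mul κ
  isDecaying_pd_pd k l i j := by
    rw [show (pd l fun y => metric κ h y i j) = fun x => κ * schwartzPd l (h i j) x from
      funext fun x => pd_metric_apply l i j x,
      show (pd k fun x => κ * schwartzPd l (h i j) x) =
        fun x => κ * schwartzPd k (schwartzPd l (h i j)) x from funext fun x => by
          rw [pd_const_mul k κ (schwartzPd l (h i j)).differentiableAt, schwartzPd_apply k]]
    exact (isDecaying_schwartz _).const_mul κ

/-- The linearised Christoffel symbols of a perturbation. -/
noncomputable def fieldChristoffel (h : Perturbation) (x : Spacetime) (β μ ν : Fin 4) : ℝ :=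
  (1 / 2) * (schwartzPd μ (h ν β) x + schwartzPd ν (h μ β) x - schwartzPd β (h μ ν) x)

theorem lowChristoffel_metric (x : Spacetime) (β μ ν : Fin 4) :
    lowChristoffel (metric κ h) β μ ν x = κ * fieldChristoffel h x β μ ν := by
  rw [lowChristoffel, pd_metric_apply, pd_metric_apply, pd_metric_apply, fieldChristoffel]
  ring

/-- The first order form of the Lagrangian. -/
noncomputable def quadraticLagrangian (κ ε : ℝ) (h : Perturbation) (x : Spacetime) : ℝ :=
  -2 * ∑ μ, ∑ ν, ∑ α, ∑ β, ∑ ρ, ∑ σ, volumeInvInvInv μ ν α β ρ σ (fieldValue κ h x) *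
    lowBilinear ε (fieldChristoffel h x) μ ν α β ρ σ

theorem integrable_lagrangian (ε : ℝ) (hs : h.IsSymm)
    (hnd : ∀ x, Nondegenerate (fieldValue κ h x)) : Integrable (lagrangian κ ε h) :=
  ((isFlatMetric_metric hs hnd).isDecaying_lagrangian κ ε).2

theorem action_eq_integral (ε : ℝ) (hκ : κ ≠ 0) (hs : h.IsSymm)
    (hnd : ∀ x, Nondegenerate (fieldValue κ h x)) :
    action κ ε h = ∫ x, quadraticLagrangian κ ε h x := by
  have h1 := (isFlatMetric_metric hs hnd).integral_lagrangian κ ε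
  refine h1.trans ?_
  congr 1
  funext x
  -- Each of the two lowered Christoffel symbols carries one factor `κ`; this is where `κ ≠ 0`
  -- enters.
  rw [quadraticLagrangian, show (-2 : ℝ) = -(2 / κ ^ 2) * κ ^ 2 by field_simp, mul_assoc]
  congr 1
  simp only [Finset.mul_sum]
  refine Finset.sum_congr rfl fun μ _ => Finset.sum_congr rfl fun ν _ =>
    sum_congr_four fun α β ρ σ => ?_
  rw [metric_eq, ← volumeInvInvInv]
  simp only [lowChristoffel_metric, lowBilinear]
  ring

theorem nondegenerate_of_isSmall (hsm : IsSmall κ h) (x : Spacetime) :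
    Nondegenerate (fieldValue κ h x) := by
  refine nondegenerate_of_spectrum fun z hz => hsm x z ?_
  have : κ • (eta * h.matrixAt x) = eta * Matrix.of (fieldValue κ h x) := by
    rw [← Matrix.mul_smul]
    rfl
  rwa [this]

end MetricOfPerturbation

/-! ### Momentum integrals with permuted legs. -/

section DeltaIntegrals

variable {m : ℕ} {ι : Type*} [Fintype ι]

theorem prod_fourier_perm (f : Fin (m + 1) → 𝓢(Spacetime, ℝ)) (π : Equiv.Perm (Fin (m + 1)))
    (p : Fin (m + 1) → Spacetime) :
    ∏ i, fourier (f i) (p (π i)) = ∏ i, fourier (f (π.symm i)) (p i) := by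
  rw [← Equiv.prod_comp π fun i => fourier (f (π.symm i)) (p i)]
  simp only [Equiv.symm_apply_apply]

theorem integrable_sum_prod_fourier (c : ι → ℂ) (f : ι → Fin (m + 1) → 𝓢(Spacetime, ℝ))
    (π : Equiv.Perm (Fin (m + 1))) :
    Integrable fun q : Fin m → Spacetime =>
      ∑ j, c j * ∏ i, fourier (f j i) (conserved q (π i)) := by
  refine integrable_finsetSum _ fun j _ => Integrable.const_mul ?_ _
  simp only [prod_fourier_perm]
  exact integrable_prod_fourier _

/-- Solving the delta function for the momentum of leg `0` singles out that leg. The symmetry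
returns in position space, where a pointwise product does not depend on the order of its factors;
hence `π` drops out. -/
theorem deltaIntegral_sum_prod_fourier (c : ι → ℂ) (f : ι → Fin (m + 1) → 𝓢(Spacetime, ℝ))
    (π : Equiv.Perm (Fin (m + 1))) :
    deltaIntegral m (fun p => ∑ j, c j * ∏ i, fourier (f j i) (p (π i))) =
      ∑ j, c j * ∫ x, ∏ i, (f j i x : ℂ) := by
  rw [deltaIntegral, integral_finsetSum _ fun j _ => Integrable.const_mul (by
    simp only [prod_fourier_perm]
    exact integrable_prod_fourier _) _, Finset.mul_sum]
  refine Finset.sum_congr rfl fun j _ => ?_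
  rw [integral_const_mul, mul_left_comm]
  congr 1
  simp only [prod_fourier_perm]
  refine (deltaIntegral_prod_fourier fun i => f j (π.symm i)).trans ?_
  congr 1
  funext x
  exact Equiv.prod_comp π.symm fun i => (f j i x : ℂ)

end DeltaIntegrals

/-! ### From momentum kernels to position space integrands. -/

section KernelContraction

variable {n : ℕ}

theorem sum_six_comm {ι : Type*} [Fintype ι]
    (F : Fin 4 → Fin 4 → Fin 4 → Fin 4 → Fin 4 → Fin 4 → ι → ℝ) :
    ∑ μ, ∑ ν, ∑ α, ∑ β, ∑ ρ, ∑ σ, ∑ j, F μ ν α β ρ σ j =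
      ∑ j, ∑ μ, ∑ ν, ∑ α, ∑ β, ∑ ρ, ∑ σ, F μ ν α β ρ σ j := by
  have := Finset.sum_comm (s := Finset.univ) (t := Finset.univ)
    (f := fun (x : Fin 4 × Fin 4 × Fin 4 × Fin 4 × Fin 4 × Fin 4) (j : ι) =>
      F x.1 x.2.1 x.2.2.1 x.2.2.2.1 x.2.2.2.2.1 x.2.2.2.2.2 j)
  simpa only [Fintype.sum_prod_type] using this

/-- The index pairs of the legs together with the two derivative indices. -/
abbrev LegIndex (n : ℕ) : Type := (Fin (n + 2) → IndexPair) × Fin 4 × Fin 4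

/-- The coefficient of `(p₁)_{l₁} (p₂)_{l₂}` in the kernel. -/
noncomputable def kernelCoeff (κ ε : ℝ) (n : ℕ) (j : LegIndex n) : ℝ :=
  2 * κ ^ n * ∑ μ, ∑ ν, ∑ α, ∑ β, ∑ ρ, ∑ σ,
    expansionCoeff (volumeInvInvInv μ ν α β ρ σ) n (fun i => j.1 i.succ.succ) *
      christoffelBilinear ε μ ν α β ρ σ j.2.1 j.2.2 (j.1 0) (j.1 1)

theorem kernel_eq_sum (κ ε : ℝ) (n : ℕ) (p : Fin (n + 2) → Spacetime)
    (a : Fin (n + 2) → IndexPair) :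
    kernel κ ε n p a = ∑ l : Fin 4 × Fin 4, kernelCoeff κ ε n (a, l) * (p 0 l.1 * p 1 l.2) := by
  simp only [kernelCoeff, mul_assoc (2 * κ ^ n), ← Finset.mul_sum, kernel]
  congr 1
  simp only [Finset.sum_mul, ← sum_six_comm]
  refine Finset.sum_congr rfl fun μ _ => Finset.sum_congr rfl fun ν _ =>
    sum_congr_four fun α β ρ σ => ?_
  rw [Fintype.sum_prod_type, Finset.mul_sum]
  refine Finset.sum_congr rfl fun l₁ _ => ?_
  rw [Finset.mul_sum]
  exact Finset.sum_congr rfl fun l₂ _ => by ring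

/-- The fields on the legs: the first two legs are differentiated. -/
noncomputable def legField (ψ : Fin (n + 2) → Perturbation) (j : LegIndex n) :
    Fin (n + 2) → 𝓢(Spacetime, ℝ) :=
  Fin.cons (schwartzPd j.2.1 (ψ 0 (j.1 0).1 (j.1 0).2))
    (Fin.cons (schwartzPd j.2.2 (ψ 1 (j.1 1).1 (j.1 1).2))
      fun i => ψ i.succ.succ (j.1 i.succ.succ).1 (j.1 i.succ.succ).2)

/-- Multiplication by `p_l` is `i` times the transform of `∂_l`; the two differentiated legs
together give `i² = -1`. -/
theorem prod_fourier_legField (ψ : Fin (n + 2) → Perturbation) (j : LegIndex n)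
    (p : Fin (n + 2) → Spacetime) :
    (p 0 j.2.1 : ℂ) * (p 1 j.2.2 : ℂ) * ∏ i, fourier (ψ i (j.1 i).1 (j.1 i).2) (p i) =
      -∏ i, fourier (legField ψ j i) (p i) := by
  have h0 := fourier_schwartzPd j.2.1 (ψ 0 (j.1 0).1 (j.1 0).2) (p 0)
  have h1 := fourier_schwartzPd j.2.2 (ψ 1 (j.1 1).1 (j.1 1).2) (p 1)
  simp only [Fin.prod_univ_succ, legField, Fin.cons_zero, Fin.cons_succ, Fin.succ_zero_eq_one]
  -- The terms convert leg `0`, then leg `1`, and finally replace `I ^ 2` by `-1`.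
  linear_combination ((p 1 j.2.2 : ℂ) * fourier (ψ 1 (j.1 1).1 (j.1 1).2) (p 1) *
      ∏ i : Fin n, fourier (ψ i.succ.succ (j.1 i.succ.succ).1 (j.1 i.succ.succ).2)
        (p i.succ.succ)) * h0 +
    (Complex.I * fourier (schwartzPd j.2.1 (ψ 0 (j.1 0).1 (j.1 0).2)) (p 0) *
      ∏ i : Fin n, fourier (ψ i.succ.succ (j.1 i.succ.succ).1 (j.1 i.succ.succ).2)
        (p i.succ.succ)) * h1 +
    (fourier (schwartzPd j.2.1 (ψ 0 (j.1 0).1 (j.1 0).2)) (p 0) *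
      fourier (schwartzPd j.2.2 (ψ 1 (j.1 1).1 (j.1 1).2)) (p 1) *
      ∏ i : Fin n, fourier (ψ i.succ.succ (j.1 i.succ.succ).1 (j.1 i.succ.succ).2)
        (p i.succ.succ)) * Complex.I_sq

theorem contract_kernel (κ ε : ℝ) (ψ : Fin (n + 2) → Perturbation) (p : Fin (n + 2) → Spacetime) :
    contract (fun p a => (kernel κ ε n p a : ℂ)) ψ p =
      ∑ j : LegIndex n, (-kernelCoeff κ ε n j : ℝ) * ∏ i, fourier (legField ψ j i) (p i) := by
  rw [contract, Fintype.sum_prod_type]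
  refine Finset.sum_congr rfl fun a _ => ?_
  rw [kernel_eq_sum, Complex.ofReal_sum, Finset.sum_mul]
  refine Finset.sum_congr rfl fun l _ => ?_
  have := prod_fourier_legField ψ (a, l) p
  push_cast
  linear_combination (kernelCoeff κ ε n (a, l) : ℂ) * this

/-- The position space integrand of the `n`-th term of the expansion of the action. -/
noncomputable def positionIntegrand (κ ε : ℝ) (ψ : Fin (n + 2) → Perturbation) (x : Spacetime) :
    ℝ :=
  ∑ j : LegIndex n, -kernelCoeff κ ε n j * ∏ i, legField ψ j i x

theorem isDecaying_prod_schwartz {m : ℕ} (f : Fin (m + 1) → 𝓢(Spacetime, ℝ)) :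
    IsDecaying fun x => ∏ i, f i x := by
  induction m with
  | zero => simpa using isDecaying_schwartz (f 0)
  | succ m ih =>
    simp only [Fin.prod_univ_succ (n := m + 1)]
    exact (isDecaying_schwartz (f 0)).mul (ih fun i => f i.succ)

theorem integrable_positionIntegrand (κ ε : ℝ) (ψ : Fin (n + 2) → Perturbation) :
    Integrable (positionIntegrand κ ε ψ) :=
  (IsDecaying.sum fun j _ => (isDecaying_prod_schwartz (legField ψ j)).const_mul _).2

theorem integral_positionIntegrand (κ ε : ℝ) (ψ : Fin (n + 2) → Perturbation) :
    ∫ x, positionIntegrand κ ε ψ x =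
      ∑ j : LegIndex n, -kernelCoeff κ ε n j * ∫ x, ∏ i, legField ψ j i x := by
  unfold positionIntegrand
  rw [integral_finsetSum _ fun j _ => ((isDecaying_prod_schwartz (legField ψ j)).const_mul _).2]
  simp only [integral_const_mul]

theorem integrable_contract_kernel (κ ε : ℝ) (ψ : Fin (n + 2) → Perturbation)
    (π : Equiv.Perm (Fin (n + 2))) :
    Integrable fun q : Fin (n + 1) → Spacetime =>
      contract (fun p a => (kernel κ ε n p a : ℂ)) ψ fun i => conserved q (π i) := by
  simp only [contract_kernel]
  exact integrable_sum_prod_fourier _ _ π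

theorem deltaIntegral_contract_kernel (κ ε : ℝ) (ψ : Fin (n + 2) → Perturbation)
    (π : Equiv.Perm (Fin (n + 2))) :
    deltaIntegral (n + 1) (fun p =>
      contract (fun p a => (kernel κ ε n p a : ℂ)) ψ fun i => p (π i)) =
      ((∫ x, positionIntegrand κ ε ψ x : ℝ) : ℂ) := by
  simp only [contract_kernel]
  rw [deltaIntegral_sum_prod_fourier, integral_positionIntegrand, Complex.ofReal_sum]
  refine Finset.sum_congr rfl fun j _ => ?_
  rw [Complex.ofReal_mul, ← integral_complex_ofReal]
  simp only [Complex.ofReal_prod]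

end KernelContraction

/-! ### Equal fields on all legs: the kernel reproduces the Taylor terms. -/

section DiagonalTerms

theorem sum_symIdentity (μ ν : Fin 4) (T : Fin 4 → Fin 4 → ℝ) (hT : ∀ i j, T i j = T j i) :
    ∑ a : IndexPair, symIdentity μ ν a * T a.1 a.2 = T μ ν := by
  have h1 : ∀ a : IndexPair, symIdentity μ ν a * T a.1 a.2 =
      1 / 2 * (kron μ a.1 * (kron ν a.2 * T a.1 a.2)) +
        1 / 2 * (kron ν a.1 * (kron μ a.2 * T a.1 a.2)) := by
    intro a
    rw [symIdentity]
    ring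
  simp only [h1, Finset.sum_add_distrib, Fintype.sum_prod_type, ← Finset.mul_sum]
  simp only [kron, ite_mul, one_mul, zero_mul, Finset.sum_ite_eq, Finset.mem_univ, if_true]
  rw [hT ν μ]
  ring

theorem sum_christoffelTensor {h : Perturbation} (hs : h.IsSymm) (x : Spacetime)
    (μ α β : Fin 4) :
    ∑ l, ∑ a : IndexPair, christoffelTensor μ α β l a * schwartzPd l (h a.1 a.2) x =
      fieldChristoffel h x μ α β := by
  have hT : ∀ l i j, schwartzPd l (h i j) x = schwartzPd l (h j i) x := fun l i j => by
    rw [hs i j]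
  have h1 : ∀ l (a : IndexPair), christoffelTensor μ α β l a * schwartzPd l (h a.1 a.2) x =
      1 / 2 * (kron l α * (symIdentity β μ a * schwartzPd l (h a.1 a.2) x)) +
      1 / 2 * (kron l β * (symIdentity α μ a * schwartzPd l (h a.1 a.2) x)) -
      1 / 2 * (kron l μ * (symIdentity α β a * schwartzPd l (h a.1 a.2) x)) := by
    intro l a
    rw [christoffelTensor]
    ring
  simp only [h1, Finset.sum_add_distrib, Finset.sum_sub_distrib, ← Finset.mul_sum]
  simp only [sum_symIdentity _ _ (fun i j => schwartzPd _ (h i j) x) (hT _)]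
  simp only [kron, ite_mul, one_mul, zero_mul, Finset.sum_ite_eq', Finset.mem_univ, if_true]
  rw [fieldChristoffel]
  ring

theorem sum_christoffelBilinear (ε : ℝ) {h : Perturbation} (hs : h.IsSymm) (x : Spacetime)
    (μ ν α β ρ σ : Fin 4) :
    ∑ l₁, ∑ a₁ : IndexPair, ∑ l₂, ∑ a₂ : IndexPair,
      christoffelBilinear ε μ ν α β ρ σ l₁ l₂ a₁ a₂ *
        (schwartzPd l₁ (h a₁.1 a₁.2) x * schwartzPd l₂ (h a₂.1 a₂.2) x) =
      lowBilinear ε (fieldChristoffel h x) μ ν α β ρ σ := by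
  have h1 : ∀ (l₁ : Fin 4) (a₁ : IndexPair) (l₂ : Fin 4) (a₂ : IndexPair),
      christoffelBilinear ε μ ν α β ρ σ l₁ l₂ a₁ a₂ *
        (schwartzPd l₁ (h a₁.1 a₁.2) x * schwartzPd l₂ (h a₂.1 a₂.2) x) =
      (christoffelTensor α μ ρ l₁ a₁ * schwartzPd l₁ (h a₁.1 a₁.2) x) *
        (christoffelTensor σ ν β l₂ a₂ * schwartzPd l₂ (h a₂.1 a₂.2) x) -
      (christoffelTensor α μ ν l₁ a₁ * schwartzPd l₁ (h a₁.1 a₁.2) x) *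
        (christoffelTensor ρ β σ l₂ a₂ * schwartzPd l₂ (h a₂.1 a₂.2) x) -
      ε / 4 * ((christoffelTensor μ α β l₁ a₁ * schwartzPd l₁ (h a₁.1 a₁.2) x) *
        (christoffelTensor ν ρ σ l₂ a₂ * schwartzPd l₂ (h a₂.1 a₂.2) x)) := by
    intros
    rw [christoffelBilinear]
    ring
  simp only [h1, Finset.sum_sub_distrib, ← Finset.mul_sum, ← Finset.sum_mul,
    sum_christoffelTensor hs x]
  rfl

/-- The sum runs over ordered pairs, so each off-diagonal component appears twice; the `1/2` in
`symUnit` compensates. With multilinearity this expands a Taylor term in the coefficients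
`expansionCoeff`. -/
theorem sum_symUnit (H : TensorValue) (hH : ∀ i j, H i j = H j i) :
    ∑ a : IndexPair, H a.1 a.2 • symUnit a = H := by
  funext μ ν
  have h1 : ∀ a : IndexPair, (H a.1 a.2 • symUnit a) μ ν = symIdentity μ ν a * H a.1 a.2 := by
    intro a
    simp only [Pi.smul_apply, symUnit, symIdentity, kron, smul_eq_mul, ite_and, mul_ite,
      mul_one, mul_zero]
    split_ifs <;> ring
  simp only [Finset.sum_apply, h1]
  exact sum_symIdentity μ ν H hH

theorem taylorTerm_eq_sum (X : TensorValue → ℝ) (n : ℕ) (H : TensorValue)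
    (hH : ∀ i j, H i j = H j i) :
    taylorTerm X n H = ∑ b : Fin n → IndexPair, expansionCoeff X n b * ∏ i, H (b i).1 (b i).2 := by
  conv_lhs => rw [taylorTerm, ← sum_symUnit H hH]
  rw [ContinuousMultilinearMap.map_sum, Finset.mul_sum]
  refine Finset.sum_congr rfl fun b _ => ?_
  rw [ContinuousMultilinearMap.map_smul_univ, expansionCoeff, smul_eq_mul]
  ring

theorem sum_five_comm {A B C D E : Type*} [Fintype A] [Fintype B] [Fintype C] [Fintype D]
    [Fintype E] (F : A → B → C → D → E → ℝ) :
    ∑ a, ∑ b, ∑ c, ∑ d, ∑ e, F a b c d e = ∑ c, ∑ d, ∑ a, ∑ e, ∑ b, F a b c d e := by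
  have := Fintype.sum_equiv
    (⟨fun x => (x.2.2.1, x.2.2.2.1, x.1, x.2.2.2.2, x.2.1),
      fun y => (y.2.2.1, y.2.2.2.2, y.1, y.2.1, y.2.2.2.1), fun _ => rfl, fun _ => rfl⟩ :
      A × B × C × D × E ≃ C × D × A × E × B)
    (fun x => F x.1 x.2.1 x.2.2.1 x.2.2.2.1 x.2.2.2.2)
    (fun y => F y.2.2.1 y.2.2.2.2 y.1 y.2.1 y.2.2.2.1) fun _ => rfl
  simpa only [Fintype.sum_prod_type] using this

theorem sum_fin_succ_arrow {m : ℕ} (G : (Fin (m + 1) → IndexPair) → ℝ) :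
    ∑ a, G a = ∑ a₁ : IndexPair, ∑ b : Fin m → IndexPair, G (Fin.cons a₁ b) := by
  rw [← (Fin.consEquiv fun _ : Fin (m + 1) => IndexPair).sum_comp, Fintype.sum_prod_type]
  rfl

/-- This summation order separates the legs of the Taylor coefficient from the two differentiated
legs and matches `sum_christoffelBilinear`. -/
theorem sum_legIndex {n : ℕ} (F : LegIndex n → ℝ) :
    ∑ j, F j = ∑ b : Fin n → IndexPair, ∑ l₁, ∑ a₁ : IndexPair, ∑ l₂, ∑ a₂ : IndexPair,
      F (Fin.cons a₁ (Fin.cons a₂ b), l₁, l₂) := by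
  rw [Fintype.sum_prod_type, sum_fin_succ_arrow,
    Finset.sum_congr rfl fun a₁ _ => sum_fin_succ_arrow _,
    Finset.sum_congr rfl fun a₁ _ => Finset.sum_congr rfl fun a₂ _ => Finset.sum_congr rfl
      fun b _ => Fintype.sum_prod_type _]
  exact sum_five_comm _

/-- The factor `κ ^ n` of the kernel is absorbed by evaluating the degree `n` Taylor term at `κ h`.
Symmetry of `h` is what allows contraction with the symmetrised tensors. -/
theorem positionIntegrand_diagonal (κ ε : ℝ) (n : ℕ) {h : Perturbation} (hs : h.IsSymm)
    (x : Spacetime) :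
    positionIntegrand κ ε (fun _ : Fin (n + 2) => h) x =
      -2 * ∑ μ, ∑ ν, ∑ α, ∑ β, ∑ ρ, ∑ σ,
        taylorTerm (volumeInvInvInv μ ν α β ρ σ) n (fieldValue κ h x) *
          lowBilinear ε (fieldChristoffel h x) μ ν α β ρ σ := by
  have hH : ∀ i j, fieldValue κ h x i j = fieldValue κ h x j i := fun i j => by
    rw [fieldValue, fieldValue, hs i j]
  have h1 : ∀ μ ν α β ρ σ, taylorTerm (volumeInvInvInv μ ν α β ρ σ) n (fieldValue κ h x) *
      lowBilinear ε (fieldChristoffel h x) μ ν α β ρ σ = ∑ j : LegIndex n, κ ^ n *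
        (expansionCoeff (volumeInvInvInv μ ν α β ρ σ) n (fun i => j.1 i.succ.succ) *
        christoffelBilinear ε μ ν α β ρ σ j.2.1 j.2.2 (j.1 0) (j.1 1)) *
          ∏ i, legField (fun _ => h) j i x := by
    intro μ ν α β ρ σ
    rw [sum_legIndex, taylorTerm_eq_sum _ _ _ hH, ← sum_christoffelBilinear ε hs x μ ν α β ρ σ,
      Finset.sum_mul]
    refine Finset.sum_congr rfl fun b _ => ?_
    simp only [Finset.mul_sum]
    refine Finset.sum_congr rfl fun l₁ _ => Finset.sum_congr rfl fun a₁ _ =>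
      Finset.sum_congr rfl fun l₂ _ => Finset.sum_congr rfl fun a₂ _ => ?_
    simp only [legField, Fin.prod_univ_succ, Fin.cons_zero, Fin.cons_succ, Fin.cons_one,
      fieldValue, Finset.prod_mul_distrib, Finset.prod_const, Finset.card_univ, Fintype.card_fin]
    ring
  simp only [h1]
  simp only [sum_six_comm]
  rw [positionIntegrand, Finset.mul_sum]
  refine Finset.sum_congr rfl fun j _ => ?_
  simp only [kernelCoeff, ← Finset.sum_mul, ← Finset.mul_sum]
  ring

end DiagonalTerms

/-! ### Summation of the perturbation series. -/

section ActionSeries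

theorem abs_sum_six_le (F : Fin 4 → Fin 4 → Fin 4 → Fin 4 → Fin 4 → Fin 4 → ℝ) :
    |∑ μ, ∑ ν, ∑ α, ∑ β, ∑ ρ, ∑ σ, F μ ν α β ρ σ| ≤
      ∑ μ, ∑ ν, ∑ α, ∑ β, ∑ ρ, ∑ σ, |F μ ν α β ρ σ| := by
  have := Finset.abs_sum_le_sum_abs
    (fun x : Fin 4 × Fin 4 × Fin 4 × Fin 4 × Fin 4 × Fin 4 =>
      F x.1 x.2.1 x.2.2.1 x.2.2.2.1 x.2.2.2.2.1 x.2.2.2.2.2) Finset.univ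
  simpa only [Fintype.sum_prod_type] using this

theorem hasSum_sum_six {F : Fin 4 → Fin 4 → Fin 4 → Fin 4 → Fin 4 → Fin 4 → ℕ → ℝ}
    {S : Fin 4 → Fin 4 → Fin 4 → Fin 4 → Fin 4 → Fin 4 → ℝ}
    (h : ∀ μ ν α β ρ σ, HasSum (F μ ν α β ρ σ) (S μ ν α β ρ σ)) :
    HasSum (fun n => ∑ μ, ∑ ν, ∑ α, ∑ β, ∑ ρ, ∑ σ, F μ ν α β ρ σ n)
      (∑ μ, ∑ ν, ∑ α, ∑ β, ∑ ρ, ∑ σ, S μ ν α β ρ σ) :=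
  hasSum_sum fun μ _ => hasSum_sum fun ν _ => hasSum_sum fun α _ => hasSum_sum fun β _ =>
    hasSum_sum fun ρ _ => hasSum_sum fun σ _ => h μ ν α β ρ σ

theorem isDecaying_fieldChristoffel (h : Perturbation) (β μ ν : Fin 4) :
    IsDecaying fun x => fieldChristoffel h x β μ ν :=
  (((isDecaying_schwartz _).add (isDecaying_schwartz _)).sub (isDecaying_schwartz _)).const_mul _

theorem isDecaying_lowBilinear (ε : ℝ) (h : Perturbation) (μ ν α β ρ σ : Fin 4) :
    IsDecaying fun x => lowBilinear ε (fieldChristoffel h x) μ ν α β ρ σ :=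
  (((isDecaying_fieldChristoffel h _ _ _).mul (isDecaying_fieldChristoffel h _ _ _)).sub
    ((isDecaying_fieldChristoffel h _ _ _).mul (isDecaying_fieldChristoffel h _ _ _))).sub
    (((isDecaying_fieldChristoffel h _ _ _).mul (isDecaying_fieldChristoffel h _ _ _)).const_mul _)

theorem integrable_sum_six_abs (M : Fin 4 → Fin 4 → Fin 4 → Fin 4 → Fin 4 → Fin 4 → ℝ) (ε : ℝ)
    (h : Perturbation) : Integrable fun x => ∑ μ, ∑ ν, ∑ α, ∑ β, ∑ ρ, ∑ σ, M μ ν α β ρ σ *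
      |lowBilinear ε (fieldChristoffel h x) μ ν α β ρ σ| :=
  integrable_finsetSum _ fun μ _ => integrable_finsetSum _ fun ν _ => integrable_finsetSum _
    fun α _ => integrable_finsetSum _ fun β _ => integrable_finsetSum _ fun ρ _ =>
      integrable_finsetSum _ fun σ _ =>
        (isDecaying_lowBilinear ε h μ ν α β ρ σ).2.abs.const_mul _

/-- The action of a uniformly nondegenerate perturbation is the sum of its perturbation series. -/
theorem hasSum_integral_positionIntegrand {κ : ℝ} (ε : ℝ) (hκ : κ ≠ 0) {h : Perturbation}
    (hs : h.IsSymm) (hnd : ∀ x, Nondegenerate (fieldValue κ h x)) :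
    HasSum (fun n : ℕ => ∫ x, positionIntegrand κ ε (fun _ : Fin (n + 2) => h) x)
      (action κ ε h) := by
  obtain ⟨s, hs1, hM⟩ := exists_taylorTerm_bound (isCompact_fieldValues κ h)
    (nondegenerate_fieldValues hnd)
  choose M hM using hM
  have hs0 : 0 < s := by linarith
  have hx := fun x μ ν α β ρ σ =>
    hM μ ν α β ρ σ (fieldValue κ h x) (Set.mem_insert_of_mem _ ⟨x, rfl⟩)
  set D : Spacetime → ℝ := fun x => ∑ μ, ∑ ν, ∑ α, ∑ β, ∑ ρ, ∑ σ, M μ ν α β ρ σ *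
    |lowBilinear ε (fieldChristoffel h x) μ ν α β ρ σ| with hD
  have hDint : Integrable D := integrable_sum_six_abs M ε h
  -- The majorant factors into a convergent geometric sequence in `n` and an integrable function of
  -- `x`, which justifies interchanging sum and integral.
  have hbound : ∀ (n : ℕ) x, ‖positionIntegrand κ ε (fun _ : Fin (n + 2) => h) x‖ ≤
      s⁻¹ ^ n * (2 * D x) := by
    intro n x
    rw [positionIntegrand_diagonal κ ε n hs, Real.norm_eq_abs, abs_mul, abs_neg, abs_two,
      mul_left_comm]
    refine mul_le_mul_of_nonneg_left ((abs_sum_six_le _).trans ?_) zero_le_two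
    simp only [hD, Finset.mul_sum]
    refine Finset.sum_le_sum fun μ _ => Finset.sum_le_sum fun ν _ => Finset.sum_le_sum fun α _ =>
      Finset.sum_le_sum fun β _ => Finset.sum_le_sum fun ρ _ => Finset.sum_le_sum fun σ _ => ?_
    rw [abs_mul, ← mul_assoc, mul_comm (s⁻¹ ^ n)]
    exact mul_le_mul_of_nonneg_right ((hx x μ ν α β ρ σ).1 n) (abs_nonneg _)
  have hsum := hasSum_integral_of_summable_integral_norm (μ := (volume : Measure Spacetime))
    (F := fun (n : ℕ) x => positionIntegrand κ ε (fun _ : Fin (n + 2) => h) x)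
    (fun n => integrable_positionIntegrand κ ε _) (by
      refine Summable.of_nonneg_of_le (fun n => integral_nonneg fun x => norm_nonneg _)
        (fun n => ?_) ((summable_geometric_of_lt_one (inv_nonneg.2 hs0.le)
          (inv_lt_one_of_one_lt₀ hs1)).mul_right (∫ x, 2 * D x))
      rw [← integral_const_mul]
      exact integral_mono (integrable_positionIntegrand κ ε _).norm
        ((hDint.const_mul 2).const_mul _) (hbound n))
  have hpt : ∀ x, HasSum (fun n : ℕ => positionIntegrand κ ε (fun _ : Fin (n + 2) => h) x)
      (quadraticLagrangian κ ε h x) := by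
    intro x
    simp only [positionIntegrand_diagonal κ ε _ hs]
    exact (hasSum_sum_six fun μ ν α β ρ σ => (hx x μ ν α β ρ σ).2.mul_right _).mul_left _
  rw [action_eq_integral ε hκ hs hnd]
  simp only [(hpt _).tsum_eq] at hsum
  exact hsum

theorem perturbation_series {κ : ℝ} (ε : ℝ) (hκ : κ ≠ 0) {h : Perturbation}
    (hs : h.IsSymm) (hsm : IsSmall κ h) :
    Integrable (lagrangian κ ε h) ∧
    (∀ n : ℕ, Integrable (fun q : Fin (n + 1) → Spacetime =>
      contract (fun p a => (kernel κ ε n p a : ℂ)) (fun _ => h) (conserved q))) ∧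
    HasSum (fun n : ℕ => deltaIntegral (n + 1)
      (contract (fun p a => (kernel κ ε n p a : ℂ)) (fun _ => h))) (action κ ε h : ℂ) := by
  have hnd := nondegenerate_of_isSmall hsm
  refine ⟨integrable_lagrangian ε hs hnd,
    fun n => integrable_contract_kernel κ ε (fun _ => h) (Equiv.refl _), ?_⟩
  have h1 := Complex.hasSum_ofReal.2 (hasSum_integral_positionIntegrand ε hκ hs hnd)
  have h2 : (fun n : ℕ => deltaIntegral (n + 1)
      (contract (fun p a => (kernel κ ε n p a : ℂ)) (fun _ => h))) = fun n : ℕ =>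
        ((∫ x, positionIntegrand κ ε (fun _ : Fin (n + 2) => h) x : ℝ) : ℂ) :=
    funext fun n => deltaIntegral_contract_kernel κ ε (fun _ => h) (Equiv.refl _)
  rw [h2]
  exact h1

end ActionSeries

/-! ### Geometric bounds on the coefficients of the action. -/

section Bounds

/-- The `n`-th derivative is a sum over `n!` permutations of a multilinear term of norm at most `C
aⁿ`; the `1/n!` in `expansionCoeff` cancels their number. -/
theorem exists_expansionCoeff_bound {X : TensorValue → ℝ} (hX : AnalyticAt ℝ X 0) :
    ∃ K : ℝ, ∀ n (b : Fin n → IndexPair), |expansionCoeff X n b| ≤ K ^ (n + 1) := by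
  obtain ⟨p, r, hp⟩ := hX
  obtain ⟨C, hC, a, ha, hbound⟩ : ∃ C > 0, ∃ a > 0, ∀ n, ‖p n‖ ≤ C * a ^ n := by
    obtain ⟨r', hr'0, hr'⟩ := ENNReal.lt_iff_exists_nnreal_btwn.1 (hp.r_pos)
    have hr'p : 0 < r' := by exact_mod_cast hr'0
    obtain ⟨C, hC, hb⟩ := p.norm_le_div_pow_of_pos_of_lt_radius hr'p (hr'.trans_le hp.r_le)
    refine ⟨C, hC, (r' : ℝ)⁻¹, by positivity, fun n => (hb n).trans_eq ?_⟩
    rw [inv_pow, div_eq_mul_inv]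
  have hunit : ∀ c : IndexPair, ‖symUnit c‖ ≤ 1 := by
    intro c
    refine (pi_norm_le_iff_of_nonneg zero_le_one).2 fun μ =>
      (pi_norm_le_iff_of_nonneg zero_le_one).2 fun ν => ?_
    rw [symUnit, Real.norm_eq_abs, abs_le]
    split_ifs <;> norm_num
  refine ⟨max C a, fun n b => ?_⟩
  have hn : (0 : ℝ) < n.factorial := by exact_mod_cast n.factorial_pos
  have h1 : |iteratedFDeriv ℝ n X 0 fun i => symUnit (b i)| ≤ n.factorial * (C * a ^ n) := by
    rw [hp.iteratedFDeriv_eq_sum_of_completeSpace]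
    refine (Finset.abs_sum_le_sum_abs _ _).trans ((Finset.sum_le_card_nsmul _ _ (C * a ^ n)
      fun π _ => ?_).trans_eq ?_)
    · refine ((p n).le_opNorm _).trans ?_
      refine (mul_le_of_le_one_right (norm_nonneg _)
        (Finset.prod_le_one (fun _ _ => norm_nonneg _) fun i _ => hunit _)).trans (hbound n)
    · rw [Finset.card_univ, Fintype.card_perm, Fintype.card_fin, nsmul_eq_mul]
  rw [expansionCoeff, abs_mul, abs_of_pos (inv_pos.2 hn)]
  calc (n.factorial : ℝ)⁻¹ * |iteratedFDeriv ℝ n X 0 fun i => symUnit (b i)|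
      ≤ (n.factorial : ℝ)⁻¹ * (n.factorial * (C * a ^ n)) := by gcongr
    _ = C * a ^ n := by field_simp
    _ ≤ max C a * max C a ^ n := by
        gcongr
        · exact le_max_left _ _
        · exact le_max_right _ _
    _ = max C a ^ (n + 1) := by rw [pow_succ, mul_comm]

theorem exists_kernelCoeff_bound (κ ε : ℝ) :
    ∃ C R : ℝ, 0 ≤ C ∧ 0 ≤ R ∧ ∀ n (j : LegIndex n), |kernelCoeff κ ε n j| ≤ C * R ^ n := by
  choose K hK using fun x : Fin 4 × Fin 4 × Fin 4 × Fin 4 × Fin 4 × Fin 4 =>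
    exists_expansionCoeff_bound (analyticAt_volumeInvInvInv x.1 x.2.1 x.2.2.1 x.2.2.2.1
      x.2.2.2.2.1 x.2.2.2.2.2)
  obtain ⟨K₀, hK₀⟩ := Finite.exists_le fun x => |K x|
  have hK₀0 : 0 ≤ K₀ := (abs_nonneg _).trans (hK₀ 0)
  obtain ⟨B, hB⟩ := Finite.exists_le
    fun y : (Fin 4 × Fin 4 × Fin 4 × Fin 4 × Fin 4 × Fin 4) ×
      (Fin 4 × Fin 4 × IndexPair × IndexPair) =>
    |christoffelBilinear ε y.1.1 y.1.2.1 y.1.2.2.1 y.1.2.2.2.1 y.1.2.2.2.2.1 y.1.2.2.2.2.2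
      y.2.1 y.2.2.1 y.2.2.2.1 y.2.2.2.2|
  have hB0 : 0 ≤ B := (abs_nonneg _).trans (hB 0)
  refine ⟨2 * ∑ μ : Fin 4, ∑ ν : Fin 4, ∑ α : Fin 4, ∑ β : Fin 4, ∑ ρ : Fin 4, ∑ σ : Fin 4,
    K₀ * B, |κ| * K₀, by positivity, by positivity, fun n j => ?_⟩
  rw [kernelCoeff, abs_mul, abs_mul, abs_two, abs_pow]
  have h1 : ∀ μ ν α β ρ σ,
      |expansionCoeff (volumeInvInvInv μ ν α β ρ σ) n (fun i => j.1 i.succ.succ) *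
        christoffelBilinear ε μ ν α β ρ σ j.2.1 j.2.2 (j.1 0) (j.1 1)| ≤ K₀ ^ n * (K₀ * B) := by
    intro μ ν α β ρ σ
    rw [abs_mul, ← mul_assoc, ← pow_succ]
    refine mul_le_mul ?_ (hB ((μ, ν, α, β, ρ, σ), j.2.1, j.2.2, j.1 0, j.1 1)) (abs_nonneg _)
      (by positivity)
    refine (hK (μ, ν, α, β, ρ, σ) n _).trans ((le_abs_self _).trans ?_)
    rw [abs_pow]
    exact pow_le_pow_left₀ (abs_nonneg _) (hK₀ _) _
  calc 2 * |κ| ^ n * |∑ μ, ∑ ν, ∑ α, ∑ β, ∑ ρ, ∑ σ,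
        expansionCoeff (volumeInvInvInv μ ν α β ρ σ) n (fun i => j.1 i.succ.succ) *
        christoffelBilinear ε μ ν α β ρ σ j.2.1 j.2.2 (j.1 0) (j.1 1)|
      ≤ 2 * |κ| ^ n * ∑ μ : Fin 4, ∑ ν : Fin 4, ∑ α : Fin 4, ∑ β : Fin 4, ∑ ρ : Fin 4,
          ∑ σ : Fin 4, K₀ ^ n * (K₀ * B) := by
        refine mul_le_mul_of_nonneg_left ((abs_sum_six_le _).trans ?_) (by positivity)
        exact Finset.sum_le_sum fun μ _ => Finset.sum_le_sum fun ν _ => Finset.sum_le_sum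
          fun α _ => Finset.sum_le_sum fun β _ => Finset.sum_le_sum fun ρ _ =>
            Finset.sum_le_sum fun σ _ => h1 μ ν α β ρ σ
    _ = _ := by
        simp only [← Finset.mul_sum, mul_pow]
        ring

variable {N : ℕ}

/-- The coefficient of `t_{j₀} ⋯ t_{j_{m+1}}` in the action of `∑ tᵢ φᵢ`. -/
noncomputable def actionCoeff (κ ε : ℝ) (φ : Fin N → Perturbation) (m : ℕ)
    (j : Fin (m + 2) → Fin N) : ℝ :=
  ∫ x, positionIntegrand κ ε (fun i => φ (j i)) x

theorem exists_legField_bound (φ : Fin N → Perturbation) :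
    ∃ B : ℝ, 0 ≤ B ∧ ∀ m (j : Fin (m + 2) → Fin N) (J : LegIndex m),
      (∀ i x, |legField (fun i => φ (j i)) J i x| ≤ B) ∧
      ∫ x, |legField (fun i => φ (j i)) J 0 x| ≤ B := by
  -- `none` stands for an undifferentiated leg and `some l` for one differentiated along `l`, so
  -- finitely many functions cover every leg at every order.
  choose C hC using fun y : Option (Fin 4) × Fin N × IndexPair =>
    (isDecaying_schwartz (y.1.elim (φ y.2.1 y.2.2.1 y.2.2.2)
      fun l => schwartzPd l (φ y.2.1 y.2.2.1 y.2.2.2))).1.2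
  obtain ⟨B₁, hB₁⟩ := Finite.exists_le fun y => |C y|
  obtain ⟨B₂, hB₂⟩ := Finite.exists_le fun y : Fin 4 × Fin N × IndexPair =>
    ∫ x, |schwartzPd y.1 (φ y.2.1 y.2.2.1 y.2.2.2) x|
  have hC' : ∀ (y : Option (Fin 4) × Fin N × IndexPair) x, |y.1.elim (φ y.2.1 y.2.2.1 y.2.2.2)
      (fun l => schwartzPd l (φ y.2.1 y.2.2.1 y.2.2.2)) x| ≤ max (max B₁ B₂) 0 := fun y x =>
    (hC y x).trans ((le_abs_self _).trans ((hB₁ y).trans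
      ((le_max_left _ _).trans (le_max_left _ _))))
  refine ⟨max (max B₁ B₂) 0, le_max_right _ _, fun m j J => ⟨?_, ?_⟩⟩
  · intro i x
    refine Fin.cases ?_ (fun i => Fin.cases ?_ (fun i => ?_) i) i
    · exact hC' (some J.2.1, j 0, J.1 0) x
    · exact hC' (some J.2.2, j 1, J.1 1) x
    · exact hC' (none, j i.succ.succ, J.1 i.succ.succ) x
  · exact (hB₂ (J.2.1, j 0, J.1 0)).trans ((le_max_right _ _).trans (le_max_left _ _))

/-- Leg `0` supplies integrability and the other `m + 1` legs are bounded, so every coefficient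
grows at most geometrically. A power series in several `tᵢ` needs this for all coefficients, beyond
convergence at each fixed `t`. -/
theorem exists_actionCoeff_bound (κ ε : ℝ) (φ : Fin N → Perturbation) :
    ∃ C R : ℝ, 0 ≤ C ∧ 0 ≤ R ∧ ∀ m j, |actionCoeff κ ε φ m j| ≤ C * R ^ m := by
  obtain ⟨C, R, hC, hR, hker⟩ := exists_kernelCoeff_bound κ ε
  obtain ⟨B, hB, hleg⟩ := exists_legField_bound φ
  -- There are `16 ^ (m + 3)` leg indices: `16` index pairs on each of `m + 2` legs and `16` pairs
  -- of derivative indices.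
  refine ⟨16 ^ 3 * C * B ^ 2, 16 * R * B, by positivity, by positivity, fun m j => ?_⟩
  have hprod : ∀ J : LegIndex m, |∫ x, ∏ i, legField (fun i => φ (j i)) J i x| ≤ B ^ (m + 2) := by
    intro J
    have hpt : ∀ x, |∏ i, legField (fun i => φ (j i)) J i x| ≤
        B ^ (m + 1) * |legField (fun i => φ (j i)) J 0 x| := by
      intro x
      rw [Fin.prod_univ_succ, abs_mul, mul_comm]
      refine mul_le_mul_of_nonneg_right ?_ (abs_nonneg _)
      rw [Finset.abs_prod]
      refine (Finset.prod_le_prod (fun _ _ => abs_nonneg _)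
        fun i _ => (hleg m j J).1 i.succ x).trans_eq ?_
      rw [Finset.prod_const, Finset.card_univ, Fintype.card_fin]
    calc |∫ x, ∏ i, legField (fun i => φ (j i)) J i x|
        ≤ ∫ x, |∏ i, legField (fun i => φ (j i)) J i x| := abs_integral_le_integral_abs
      _ ≤ ∫ x, B ^ (m + 1) * |legField (fun i => φ (j i)) J 0 x| :=
          integral_mono (isDecaying_prod_schwartz _).2.abs
            ((isDecaying_schwartz _).2.abs.const_mul _) hpt
      _ ≤ B ^ (m + 1) * B := by
          rw [integral_const_mul]
          exact mul_le_mul_of_nonneg_left (hleg m j J).2 (by positivity)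
      _ = B ^ (m + 2) := by rw [← pow_succ]
  rw [actionCoeff, integral_positionIntegrand]
  calc |∑ J : LegIndex m, -kernelCoeff κ ε m J * ∫ x, ∏ i, legField (fun i => φ (j i)) J i x|
      ≤ ∑ J : LegIndex m, C * R ^ m * B ^ (m + 2) := by
        refine (Finset.abs_sum_le_sum_abs _ _).trans (Finset.sum_le_sum fun J _ => ?_)
        rw [abs_mul, abs_neg]
        exact mul_le_mul (hker m J) (hprod J) (abs_nonneg _) (by positivity)
    _ = _ := by
        rw [Finset.sum_const, Finset.card_univ, nsmul_eq_mul]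
        simp only [Fintype.card_prod, Fintype.card_fun, Fintype.card_fin]
        push_cast
        ring

end Bounds

/-! ### Analyticity of the action in the amplitudes, and the vertices. -/

section Superposition

variable {N m : ℕ}

/-- The perturbation `∑ tᵢ φᵢ`. -/
noncomputable def superpose (φ : Fin N → Perturbation) (t : Fin N → ℝ) : Perturbation :=
  fun μ ν => ∑ i, t i • φ i μ ν

theorem isSymm_superpose {φ : Fin N → Perturbation} (hφ : ∀ i, (φ i).IsSymm) (t : Fin N → ℝ) :
    (superpose φ t).IsSymm := fun μ ν =>
  Finset.sum_congr rfl fun i _ => by rw [hφ i μ ν]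

theorem superpose_apply (φ : Fin N → Perturbation) (t : Fin N → ℝ) (μ ν : Fin 4)
    (x : Spacetime) : superpose φ t μ ν x = ∑ i, t i * φ i μ ν x := by
  simp [superpose]

theorem schwartzPd_superpose (φ : Fin N → Perturbation) (t : Fin N → ℝ) (l μ ν : Fin 4)
    (x : Spacetime) :
    schwartzPd l (superpose φ t μ ν) x = ∑ i, t i * schwartzPd l (φ i μ ν) x := by
  simp [superpose, schwartzPd, LineDeriv.lineDerivOp_smul]

theorem legField_superpose (φ : Fin N → Perturbation) (t : Fin N → ℝ) (J : LegIndex m)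
    (i : Fin (m + 2)) (x : Spacetime) :
    legField (fun _ => superpose φ t) J i x = ∑ k, t k * legField (fun _ => φ k) J i x := by
  refine Fin.cases ?_ (fun i => Fin.cases ?_ (fun i => ?_) i) i
  · exact schwartzPd_superpose φ t _ _ _ x
  · exact schwartzPd_superpose φ t _ _ _ x
  · exact superpose_apply φ t _ _ x

theorem legField_comp (φ : Fin N → Perturbation) (j : Fin (m + 2) → Fin N) (J : LegIndex m)
    (i : Fin (m + 2)) :
    legField (fun i => φ (j i)) J i = legField (fun _ => φ (j i)) J i :=
  Fin.cases rfl (fun i => Fin.cases rfl (fun _ => rfl) i) i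

theorem positionIntegrand_superpose (κ ε : ℝ) (φ : Fin N → Perturbation) (t : Fin N → ℝ)
    (x : Spacetime) :
    positionIntegrand κ ε (fun _ : Fin (m + 2) => superpose φ t) x =
      ∑ j : Fin (m + 2) → Fin N, (∏ i, t (j i)) *
        positionIntegrand κ ε (fun i => φ (j i)) x := by
  simp only [positionIntegrand, Finset.mul_sum]
  rw [Finset.sum_comm]
  refine Finset.sum_congr rfl fun J _ => ?_
  simp only [legField_superpose]
  rw [Finset.prod_univ_sum, Fintype.piFinset_univ, Finset.mul_sum]
  refine Finset.sum_congr rfl fun j _ => ?_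
  rw [Finset.prod_mul_distrib, mul_left_comm]
  congr 2
  exact Finset.prod_congr rfl fun i _ => by rw [legField_comp φ j]

theorem integral_positionIntegrand_superpose (κ ε : ℝ) (φ : Fin N → Perturbation)
    (t : Fin N → ℝ) :
    ∫ x, positionIntegrand κ ε (fun _ : Fin (m + 2) => superpose φ t) x =
      ∑ j : Fin (m + 2) → Fin N, (∏ i, t (j i)) * actionCoeff κ ε φ m j := by
  simp only [positionIntegrand_superpose]
  rw [integral_finsetSum _ fun j _ => (integrable_positionIntegrand κ ε _).const_mul _]
  simp only [integral_const_mul, actionCoeff]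

/-- The homogeneous terms of the action of `∑ tᵢ φᵢ`, as multilinear maps in `t`. -/
noncomputable def actionTerm (κ ε : ℝ) (φ : Fin N → Perturbation) (m : ℕ) :
    ContinuousMultilinearMap ℝ (fun _ : Fin (m + 2) => Fin N → ℝ) ℝ :=
  ∑ j : Fin (m + 2) → Fin N, actionCoeff κ ε φ m j •
    (ContinuousMultilinearMap.mkPiAlgebra ℝ (Fin (m + 2)) ℝ).compContinuousLinearMap
      fun i => ContinuousLinearMap.proj (R := ℝ) (φ := fun _ : Fin N => ℝ) (j i)

theorem actionTerm_apply (κ ε : ℝ) (φ : Fin N → Perturbation) (v : Fin (m + 2) → Fin N → ℝ) :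
    actionTerm κ ε φ m v =
      ∑ j : Fin (m + 2) → Fin N, actionCoeff κ ε φ m j * ∏ i, v i (j i) := by
  simp [actionTerm]

/-- The Taylor series of the action of `∑ tᵢ φᵢ` in `t`. -/
noncomputable def actionSeries (κ ε : ℝ) (φ : Fin N → Perturbation) :
    FormalMultilinearSeries ℝ (Fin N → ℝ) ℝ
  -- Every term contains two differentiated legs, so the action starts at second order.
  | 0 => 0
  | 1 => 0
  | m + 2 => actionTerm κ ε φ m

theorem exists_norm_actionTerm_bound (κ ε : ℝ) (φ : Fin N → Perturbation) :
    ∃ C R : ℝ, 0 ≤ C ∧ 0 ≤ R ∧ ∀ m, ‖actionTerm κ ε φ m‖ ≤ C * R ^ m := by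
  obtain ⟨C, R, hC, hR, hb⟩ := exists_actionCoeff_bound κ ε φ
  refine ⟨N ^ 2 * C, N * R, by positivity, by positivity, fun m => ?_⟩
  refine ContinuousMultilinearMap.opNorm_le_bound (by positivity) fun v => ?_
  rw [actionTerm_apply, Real.norm_eq_abs]
  calc |∑ j : Fin (m + 2) → Fin N, actionCoeff κ ε φ m j * ∏ i, v i (j i)|
      ≤ ∑ j : Fin (m + 2) → Fin N, C * R ^ m * ∏ i, ‖v i‖ := by
        refine (Finset.abs_sum_le_sum_abs _ _).trans (Finset.sum_le_sum fun j _ => ?_)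
        rw [abs_mul, Finset.abs_prod]
        exact mul_le_mul (hb m j) (Finset.prod_le_prod (fun _ _ => abs_nonneg _)
          fun i _ => norm_le_pi_norm (v i) (j i)) (Finset.prod_nonneg fun _ _ => abs_nonneg _)
          (by positivity)
    _ = _ := by
        rw [Finset.sum_const, Finset.card_univ, nsmul_eq_mul]
        simp only [Fintype.card_fun, Fintype.card_fin]
        push_cast
        ring

theorem exists_nondegenerate_superpose (κ : ℝ) (φ : Fin N → Perturbation) :
    ∃ δ > 0, ∀ t : Fin N → ℝ, ‖t‖ < δ →
      ∀ x, Nondegenerate (fieldValue κ (superpose φ t) x) := by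
  obtain ⟨r, hr, hball⟩ := Metric.eventually_nhds_iff.1 eventually_nondegenerate
  choose C hC using fun y : Fin N × Fin 4 × Fin 4 =>
    (isDecaying_schwartz (φ y.1 y.2.1 y.2.2)).1.2
  obtain ⟨B, hB⟩ := Finite.exists_le fun y => |C y|
  -- The summand `1` keeps `K` positive, since `κ` may vanish here.
  set K : ℝ := |κ| * (N * max B 0) + 1 with hK
  have hK0 : 0 < K := by positivity
  refine ⟨r / K, by positivity, fun t ht x => hball ?_⟩
  rw [dist_zero_right]
  have hle : ‖fieldValue κ (superpose φ t) x‖ ≤ K * ‖t‖ := by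
    refine (pi_norm_le_iff_of_nonneg (by positivity)).2 fun μ =>
      (pi_norm_le_iff_of_nonneg (by positivity)).2 fun ν => ?_
    rw [fieldValue, superpose_apply, norm_mul, Real.norm_eq_abs κ]
    have h1 : ‖∑ i, t i * φ i μ ν x‖ ≤ ∑ _i : Fin N, ‖t‖ * max B 0 := by
      refine (norm_sum_le _ _).trans (Finset.sum_le_sum fun i _ => ?_)
      rw [norm_mul]
      exact mul_le_mul (norm_le_pi_norm t i) ((hC (i, μ, ν) x).trans ((le_abs_self _).trans
        ((hB _).trans (le_max_left _ _)))) (norm_nonneg _) (norm_nonneg _)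
    rw [Finset.sum_const, Finset.card_univ, Fintype.card_fin, nsmul_eq_mul] at h1
    calc |κ| * ‖∑ i, t i * φ i μ ν x‖ ≤ |κ| * (N * (‖t‖ * max B 0)) := by gcongr
      _ = |κ| * (N * max B 0) * ‖t‖ := by ring
      _ ≤ K * ‖t‖ := by
        gcongr
        linarith
  refine hle.trans_lt ?_
  rw [lt_div_iff₀ hK0] at ht
  linarith

/-- The coefficient bounds give a positive radius of convergence, and the perturbation series of `∑
tᵢ φᵢ`, valid while that field is nondegenerate, identifies the sum. -/
theorem exists_hasFPowerSeriesOnBall_action {κ : ℝ} (ε : ℝ) (hκ : κ ≠ 0)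
    {φ : Fin N → Perturbation} (hφ : ∀ i, (φ i).IsSymm) :
    ∃ r, HasFPowerSeriesOnBall (fun t => action κ ε (superpose φ t))
      (actionSeries κ ε φ) 0 r := by
  obtain ⟨C, R, hC, hR, hb⟩ := exists_norm_actionTerm_bound κ ε φ
  obtain ⟨δ, hδ, hnd⟩ := exists_nondegenerate_superpose κ φ
  -- `r ≤ δ` ensures nondegeneracy; `r ≤ 1` and `R r ≤ 1` bound `C R ^ m r ^ (m + 2)` by `C`.
  obtain ⟨r, hr0, hr⟩ : ∃ r : NNReal, 0 < r ∧ (r : ℝ) ≤ δ ∧ (r : ℝ) ≤ 1 ∧ R * r ≤ 1 := by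
    refine ⟨⟨min δ (R + 1)⁻¹, by positivity⟩, ?_, min_le_left _ _, ?_, ?_⟩
    · exact NNReal.coe_pos.1 (lt_min hδ (by positivity))
    · exact (min_le_right _ _).trans (inv_le_one_of_one_le₀ (by linarith))
    · calc R * min δ (R + 1)⁻¹ ≤ (R + 1) * (R + 1)⁻¹ := by
            gcongr
            · linarith
            · exact min_le_right _ _
        _ = 1 := mul_inv_cancel₀ (by positivity)
  refine ⟨r, ⟨FormalMultilinearSeries.le_radius_of_bound _ C fun n => ?_, by exact_mod_cast hr0,
    fun {t} ht => ?_⟩⟩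
  · match n with
    | 0 => simpa [actionSeries] using hC
    | 1 => simpa [actionSeries] using hC
    | m + 2 =>
      calc ‖actionTerm κ ε φ m‖ * (r : ℝ) ^ (m + 2) ≤ C * R ^ m * (r : ℝ) ^ (m + 2) := by
            gcongr
            exact hb m
        _ = C * ((R * r) ^ m * (r : ℝ) ^ 2) := by ring
        _ ≤ C * (1 * 1) := by
            gcongr
            · exact pow_le_one₀ (by positivity) hr.2.2
            · exact pow_le_one₀ (by positivity) hr.2.1
        _ = C := by ring
  · have ht' : ‖t‖ < δ := by
      have : ‖t‖ < r := by simpa [Metric.mem_eball, edist_zero_right, enorm_lt_coe] using ht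
      exact this.trans_le hr.1
    rw [zero_add, ← hasSum_nat_add_iff' 2]
    have h0 : ∑ i ∈ Finset.range 2, (actionSeries κ ε φ i fun _ => t) = 0 := by
      simp [Finset.sum_range_succ, actionSeries]
    rw [h0, sub_zero]
    have h1 := hasSum_integral_positionIntegrand ε hκ (isSymm_superpose hφ t) (hnd t ht')
    have h2 : (fun m => actionSeries κ ε φ (m + 2) fun _ => t) = fun m : ℕ =>
        ∫ x, positionIntegrand κ ε (fun _ : Fin (m + 2) => superpose φ t) x := by
      funext m
      rw [integral_positionIntegrand_superpose]
      refine (actionTerm_apply κ ε φ _).trans (Finset.sum_congr rfl fun j _ => mul_comm _ _)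
    rw [h2]
    exact h1

/-- `actionTerm` need not be symmetric, so the derivative is its sum over permuted arguments. On the
basis vectors permuted by `π`, the product `∏ v i (j i)` is nonzero only for `j = π`. -/
theorem iteratedFDeriv_action {κ : ℝ} (ε : ℝ) (hκ : κ ≠ 0) {n : ℕ}
    {φ : Fin (n + 2) → Perturbation} (hφ : ∀ i, (φ i).IsSymm) :
    iteratedFDeriv ℝ (n + 2) (fun t => action κ ε (superpose φ t)) 0
        (fun i => Pi.single i 1) =
      ∑ π : Equiv.Perm (Fin (n + 2)), actionCoeff κ ε φ n π := by
  obtain ⟨r, hr⟩ := exists_hasFPowerSeriesOnBall_action ε hκ hφ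
  rw [hr.iteratedFDeriv_eq_sum_of_completeSpace]
  refine Finset.sum_congr rfl fun π _ => ?_
  refine (actionTerm_apply κ ε φ _).trans ?_
  rw [Finset.sum_eq_single (π : Fin (n + 2) → Fin (n + 2))]
  · simp
  · intro j _ hj
    obtain ⟨i, hi⟩ := Function.ne_iff.1 hj
    rw [Finset.prod_eq_zero (Finset.mem_univ i) (Pi.single_eq_of_ne hi _), mul_zero]
  · exact fun h => absurd (Finset.mem_univ _) h

theorem contract_vertex (κ ε : ℝ) {n : ℕ} (φ : Fin (n + 2) → Perturbation)
    (p : Fin (n + 2) → Spacetime) :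
    contract (vertex κ ε n) φ p = Complex.I * ∑ π : Equiv.Perm (Fin (n + 2)),
      contract (fun p a => (kernel κ ε n p a : ℂ)) (fun i => φ (π i)) fun i => p (π i) := by
  have h1 : ∀ π : Equiv.Perm (Fin (n + 2)),
      contract (fun p a => (kernel κ ε n p a : ℂ)) (fun i => φ (π i)) (fun i => p (π i)) =
        ∑ a : Fin (n + 2) → IndexPair, (kernel κ ε n (p ∘ π) (a ∘ π) : ℂ) *
          ∏ i, fourier (φ i (a i).1 (a i).2) (p i) := by
    intro π
    -- Relabelling the summed index pairs by `π` transfers the permutation from the fields to the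
    -- arguments of the kernel.
    rw [contract, ← (Equiv.arrowCongr π.symm (Equiv.refl IndexPair)).sum_comp]
    refine Finset.sum_congr rfl fun a _ => congrArg (_ * ·) ?_
    exact Equiv.prod_comp π fun i => fourier (φ i (a i).1 (a i).2) (p i)
  rw [Finset.sum_congr rfl fun π _ => h1 π, Finset.sum_comm, contract, Finset.mul_sum]
  refine Finset.sum_congr rfl fun a _ => ?_
  rw [vertex, mul_assoc, Finset.sum_mul]

theorem integrable_contract_vertex (κ ε : ℝ) {n : ℕ} (φ : Fin (n + 2) → Perturbation) :
    Integrable fun q : Fin (n + 1) → Spacetime =>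
      contract (vertex κ ε n) φ (conserved q) := by
  have h1 : Integrable fun q : Fin (n + 1) → Spacetime => ∑ π : Equiv.Perm (Fin (n + 2)),
      contract (fun p a => (kernel κ ε n p a : ℂ)) (fun i => φ (π i))
        fun i => conserved q (π i) :=
    integrable_finsetSum _ fun π _ => integrable_contract_kernel κ ε (fun i => φ (π i)) π
  simp only [contract_vertex]
  exact h1.const_mul _

theorem deltaIntegral_contract_vertex (κ ε : ℝ) {n : ℕ} (φ : Fin (n + 2) → Perturbation) :
    deltaIntegral (n + 1) (contract (vertex κ ε n) φ) =
      Complex.I * ((∑ π : Equiv.Perm (Fin (n + 2)), actionCoeff κ ε φ n π : ℝ) : ℂ) := by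
  simp only [Complex.ofReal_sum, actionCoeff]
  simp only [← fun π : Equiv.Perm (Fin (n + 2)) =>
    deltaIntegral_contract_kernel κ ε (fun i => φ (π i)) π]
  simp only [deltaIntegral, contract_vertex]
  rw [integral_const_mul, integral_finsetSum _ fun π _ =>
    integrable_contract_kernel κ ε (fun i => φ (π i)) π, ← Finset.mul_sum, mul_left_comm]

end Superposition

end PerturbativeGravity

theorem mainTheorem10 (κ ε : ℝ) (hκ : κ ≠ 0) :
    (∀ h : PerturbativeGravity.Perturbation, h.IsSymm → PerturbativeGravity.IsSmall κ h →
      MeasureTheory.Integrable (PerturbativeGravity.lagrangian κ ε h) ∧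
      (∀ n : ℕ, MeasureTheory.Integrable (fun q : Fin (n + 1) → PerturbativeGravity.Spacetime =>
        PerturbativeGravity.contract
          (fun p a => (PerturbativeGravity.kernel κ ε n p a : ℂ)) (fun _ => h)
          (PerturbativeGravity.conserved q))) ∧
      HasSum (fun n : ℕ => PerturbativeGravity.deltaIntegral (n + 1)
        (PerturbativeGravity.contract
          (fun p a => (PerturbativeGravity.kernel κ ε n p a : ℂ)) (fun _ => h)))
        (PerturbativeGravity.action κ ε h : ℂ)) ∧
    (∀ (n : ℕ) (φ : Fin (n + 2) → PerturbativeGravity.Perturbation), (∀ i, (φ i).IsSymm) →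
      AnalyticAt ℝ (fun t : Fin (n + 2) → ℝ =>
        PerturbativeGravity.action κ ε (fun μ ν => ∑ i, t i • φ i μ ν)) 0 ∧
      MeasureTheory.Integrable (fun q : Fin (n + 1) → PerturbativeGravity.Spacetime =>
        PerturbativeGravity.contract (PerturbativeGravity.vertex κ ε n) φ
          (PerturbativeGravity.conserved q)) ∧
      Complex.I * ((iteratedFDeriv ℝ (n + 2) (fun t : Fin (n + 2) → ℝ =>
          PerturbativeGravity.action κ ε (fun μ ν => ∑ i, t i • φ i μ ν)) 0
            (fun i => Pi.single i 1) : ℝ) : ℂ) =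
        PerturbativeGravity.deltaIntegral (n + 1)
          (PerturbativeGravity.contract (PerturbativeGravity.vertex κ ε n) φ)) := by
  refine ⟨fun h hs hsm => PerturbativeGravity.perturbation_series ε hκ hs hsm,
    fun n φ hφ => ?_⟩
  obtain ⟨r, hr⟩ := PerturbativeGravity.exists_hasFPowerSeriesOnBall_action ε hκ hφ
  refine ⟨hr.analyticAt, PerturbativeGravity.integrable_contract_vertex κ ε φ, ?_⟩
  rw [PerturbativeGravity.deltaIntegral_contract_vertex]
  exact congrArg (fun y : ℝ => Complex.I * (y : ℂ))
    (PerturbativeGravity.iteratedFDeriv_action ε hκ hφ)
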